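/- Let $0\le q<n$, let $S^n\subset\mathbb R^{n+1}$ be the round unit sphere, and identify $T^*S^n=\{(x,\xi)\in\mathbb R^{n+1}\times\mathbb R^{n+1}: |x|=1,\ \langle x,\xi\rangle=0\}$ with the complex quadric $Q=\{z\in\mathbb C^{n+1}:\sum_{k=0}^n z_k^2=1\}$ via $\Psi(x,\xi)=x\cosh|\xi|+i\,\frac{\xi}{|\xi|}\sinh|\xi|$. Let $\Omega$ be the holomorphic $(n,0)$-form on $Q$ determined by $\tfrac12 d\bigl(\sum_k z_k^2\bigr)\wedge\Omega=dz_0\wedge\dots\wedge dz_n$, and let $\omega_{\mathrm{St}}=\frac i2\,\partial\bar\partial\, v(|z|^2)$ be the Kähler form of the Stenzel metric on $Q$, where $v(\cosh t)=f(t)$ for $t\ge 0$ and $f$ is the Ricci-flat profile: $\frac{d}{dt}\bigl(f'(t)^n\bigr)=n\sinh^{n-1}t$, $f'\ge 0$, $f'(0)=0$, $f(0)=0$. Let $x:L\to S^n$ be a smooth immersion of a smooth $q$-dimensional manifold and let $\mu\in\Omega^1(L)$ be a smooth $1$-form, where $T_p^*L$ is viewed inside $T^*_{x(p)}S^n$ by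 means of the round metric. Consider the immersed submanifold $$N^*L+\mu=\{(p,\xi+\mu(p)) : p\in L,\ \xi\in N_p^*L\}$$ of $T^*S^n$, where $N^*_pL\subset T^*_{x(p)}S^n$ is the conormal space. It is called special Lagrangian if for some $\theta\in\mathbb R$ both $\omega_{\mathrm{St}}$ and $\operatorname{Im}(e^{-i\theta}\Omega)$ vanish on it. The immersion $L$ is called austere in $S^n$ if for every normal vector field $\nu$ and every point of $L$ the eigenvalues of the second fundamental form $A^\nu(w)=(\nabla_w\nu)^T$, counted with multiplicity, are invariant under multiplication by $-1$. Then $N^*L+\mu$ is special Lagrangian in $T^*S^n$ with the Stenzel metric if and only if $L$ is austere in $S^n$ and $\mu=0$. -/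

import Mathlib

open scoped Manifold ContDiff Topology RealInnerProductSpace ComplexConjugate

noncomputable section

namespace StenzelSphere

/-- The real coordinate space `ℝ^m` with its Euclidean inner product. -/
abbrev E (m : ℕ) : Type := EuclideanSpace ℝ (Fin m)

/-- The unit sphere `S^n ⊆ ℝ^{n+1}`. -/
abbrev Sph (n : ℕ) : Type := Metric.sphere (0 : E (n + 1)) 1

/-! ### The Stenzel Kähler form and the holomorphic volume form on the complex quadric

`Q = {z ∈ ℂ^{n+1} | ∑ z_k ^ 2 = 1}`, with tangent spaces `T_z Q = {X | ∑ z_k X_k = 0}`. -/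

/-- The derivative `f'(t)` of the Ricci-flat profile `f`: the nonnegative solution of
`d/dt (f' ^ n) = n * (sinh t) ^ (n - 1)`, `f'(0) = 0`. -/
def profileSlope (n : ℕ) (t : ℝ) : ℝ :=
  ((n : ℝ) * ∫ σ in (0 : ℝ)..t, Real.sinh σ ^ (n - 1)) ^ (1 / (n : ℝ))

/-- The Ricci-flat profile `f`, with `f(0) = 0`. -/
def profile (n : ℕ) (t : ℝ) : ℝ := ∫ σ in (0 : ℝ)..t, profileSlope n σ

/-- The Stenzel potential as a function of `w = |z|² ∈ [1, ∞)`, where `|z|² = cosh t`. It solves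
`w * (v') ^ n + (w ^ 2 - 1) * v'' * (v') ^ (n - 1) = 1`. -/
def potential (n : ℕ) (w : ℝ) : ℝ := profile n (Real.arcosh w)

/-- `v'`, as a function on `[1, ∞)` (one-sided at the end point). -/
def potentialDeriv (n : ℕ) (w : ℝ) : ℝ := derivWithin (potential n) (Set.Ici 1) w

/-- `v''`, as a function on `[1, ∞)` (one-sided at the end point). -/
def potentialDeriv2 (n : ℕ) (w : ℝ) : ℝ := derivWithin (potentialDeriv n) (Set.Ici 1) w

/-- `|z|² = ∑ |z_k|²`. -/
def sqNorm {n : ℕ} (z : Fin (n + 1) → ℂ) : ℝ := ∑ k, Complex.normSq (z k)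

/-- `∂|z|² = ∑ conj z_k dz_k`, evaluated on a vector `X`. -/
def delSqNorm {n : ℕ} (z X : Fin (n + 1) → ℂ) : ℂ := ∑ k, conj (z k) * X k

/-- The Kähler form `ω = (i/2) ∂∂̄ v(|z|²)` of the Stenzel metric at `z ∈ Q`, evaluated on
`X, Y ∈ T_z Q`; it is the restriction to `Q` of
`(i/2) (v' ∑ dz_k ∧ dz̄_k + v'' ∂|z|² ∧ ∂̄|z|²)`. -/
def kahlerForm {n : ℕ} (z X Y : Fin (n + 1) → ℂ) : ℂ :=
  (Complex.I / 2) *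
    ((potentialDeriv n (sqNorm z) : ℂ) * ∑ k, (X k * conj (Y k) - Y k * conj (X k)) +
     (potentialDeriv2 n (sqNorm z) : ℂ) *
      (delSqNorm z X * conj (delSqNorm z Y) - delSqNorm z Y * conj (delSqNorm z X)))

/-- The holomorphic volume form `Ω` on `Q`, that is the form on `T_z Q` determined by
`(1/2) d(∑ z_k ^ 2) ∧ Ω = dz_0 ∧ ⋯ ∧ dz_n`. As `z` is a vector on which `(1/2) d(∑ z_k ^ 2)`
takes the value `1` on `Q`, it is `Ω_z(V_1, …, V_n) = det (z, V_1, …, V_n)`. -/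
def holVolForm {n : ℕ} (z : Fin (n + 1) → ℂ) (V : Fin n → Fin (n + 1) → ℂ) : ℂ :=
  Matrix.det (Matrix.of (Fin.cons z V : Fin (n + 1) → Fin (n + 1) → ℂ))

/-- The diffeomorphism `T^*S^n → Q`, `(x, ξ) ↦ x cosh|ξ| + i (ξ/|ξ|) sinh|ξ|`. A covector at
`x ∈ S^n` is represented by a vector `ξ ∈ ℝ^{n+1}` with `⟪x, ξ⟫ = 0`. -/
def toQuadric {n : ℕ} (x ξ : E (n + 1)) : Fin (n + 1) → ℂ := fun k =>
  ((Real.cosh ‖ξ‖ * x k : ℝ) : ℂ) + Complex.I * ((Real.sinh ‖ξ‖ / ‖ξ‖ * ξ k : ℝ) : ℂ)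

/-! ### Immersed submanifolds of the sphere -/

/-- A smooth immersion of a `q`-dimensional manifold `L` into `S^n`. -/
structure SphereImmersion (q n : ℕ) (L : Type*) [TopologicalSpace L] [ChartedSpace (E q) L] where
  toFun : L → Sph n
  smooth : ContMDiff (𝓡 q) (𝓡 n) ∞ toFun
  immersion : ∀ p : L, Function.Injective (mfderiv (𝓡 q) (𝓡 n) toFun p)

section

variable {q n : ℕ} {L : Type*} [TopologicalSpace L] [ChartedSpace (E q) L]

namespace SphereImmersion

/-- The immersion, regarded as a map into `ℝ^{n+1}`. -/
def pt (x : SphereImmersion q n L) (p : L) : E (n + 1) := (x.toFun p : E (n + 1))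

/-- The differential `dx_p : T_p L → ℝ^{n+1}`. -/
def dx (x : SphereImmersion q n L) (p : L) : TangentSpace (𝓡 q) p →L[ℝ] E (n + 1) :=
  mfderiv (𝓡 q) 𝓘(ℝ, E (n + 1)) x.pt p

theorem dx_injective (x : SphereImmersion q n L) (p : L) : Function.Injective (x.dx p) := by
  have : Fact (Module.finrank ℝ (E (n + 1)) = n + 1) := ⟨by simp⟩
  have h : mfderiv (𝓡 q) 𝓘(ℝ, E (n + 1)) ((fun y : Sph n => (y : E (n + 1))) ∘ x.toFun) p =
      (mfderiv (𝓡 n) 𝓘(ℝ, E (n + 1)) (fun y : Sph n => (y : E (n + 1))) (x.toFun p)).comp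
        (mfderiv (𝓡 q) (𝓡 n) x.toFun p) :=
    mfderiv_comp p ((contMDiff_coe_sphere (m := 1)).mdifferentiable one_ne_zero _)
      (x.smooth.mdifferentiable (by simp) p)
  have h2 : x.dx p = (mfderiv (𝓡 n) 𝓘(ℝ, E (n + 1)) (fun y : Sph n => (y : E (n + 1)))
      (x.toFun p)).comp (mfderiv (𝓡 q) (𝓡 n) x.toFun p) := h
  rw [h2]
  exact (injective_mvfderiv_subtypeVal_sphere (x.toFun p)).comp (x.immersion p)

/-- The tangent space `dx(T_p L) ⊆ ℝ^{n+1}`. -/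
def tangent (x : SphereImmersion q n L) (p : L) : Submodule ℝ (E (n + 1)) :=
  LinearMap.range (x.dx p).toLinearMap

/-- The normal space `N_p L ⊆ T_{x(p)} S^n`, and, by the identification of covectors with
vectors, also the conormal space `N^*_p L ⊆ T^*_{x(p)} S^n`. -/
def normal (x : SphereImmersion q n L) (p : L) : Submodule ℝ (E (n + 1)) where
  carrier := {ν | ⟪x.pt p, ν⟫ = 0 ∧ ∀ w, ⟪x.dx p w, ν⟫ = 0}
  add_mem' := by
    rintro a b ⟨ha, ha'⟩ ⟨hb, hb'⟩
    exact ⟨by rw [inner_add_right, ha, hb, add_zero],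
      fun w => by rw [inner_add_right, ha' w, hb' w, add_zero]⟩
  zero_mem' := ⟨inner_zero_right _, fun _ => inner_zero_right _⟩
  smul_mem' := by
    rintro c a ⟨ha, ha'⟩
    exact ⟨by rw [inner_smul_right, ha, mul_zero],
      fun w => by rw [inner_smul_right, ha' w, mul_zero]⟩

/-! ### Second fundamental form and austerity -/

/-- A smooth section of the normal bundle `N L`. -/
structure IsNormalField (x : SphereImmersion q n L) (ν : L → E (n + 1)) : Prop where
  smooth : ContMDiff (𝓡 q) 𝓘(ℝ, E (n + 1)) ∞ ν
  normal : ∀ p, ν p ∈ x.normal p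

/-- The second fundamental form `A^ν(w) = (∇_w ν)^T` at `p`, as an endomorphism of `T_p L`.
The Levi-Civita derivative `∇_w ν` in `S^n` is the projection of `dν(w)` to `T S^n`; since
`dx(T_p L)` is contained in the latter, `(∇_w ν)^T` is the orthogonal projection of `dν(w)` to
`dx(T_p L) ≅ T_p L`. -/
def shapeOperator (x : SphereImmersion q n L) (ν : L → E (n + 1)) (p : L) :
    E q →ₗ[ℝ] E q :=
  (LinearEquiv.ofInjective (x.dx p).toLinearMap (x.dx_injective p)).symm.toLinearMap ∘ₗ
    (x.tangent p).orthogonalProjectionOnto.toLinearMap ∘ₗ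
      (mfderiv (𝓡 q) 𝓘(ℝ, E (n + 1)) ν p).toLinearMap

/-- `L` is austere: for every normal field, at every point, the eigenvalues of `A^ν`, counted with
multiplicity, are invariant under multiplication by `-1`. -/
def IsAustere (x : SphereImmersion q n L) : Prop :=
  ∀ ν : L → E (n + 1), x.IsNormalField ν → ∀ p : L,
    (x.shapeOperator ν p).charpoly.roots.map (fun r => -r) = (x.shapeOperator ν p).charpoly.roots

/-! ### The twisted conormal bundle -/

/-- The fibre over `p ∈ L` of `N^*L + μ`: all covectors `ξ + μ(p)` with `ξ ∈ N^*_p L`. Here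
`μ(p) ∈ T_p^*L` is the covector of `S^n` represented by the `m ∈ dx(T_p L)` with
`⟪m, dx w⟫ = μ(p)(w)`. -/
def twistedFibre (x : SphereImmersion q n L)
    (μ : ∀ p : L, TangentSpace (𝓡 q) p →L[ℝ] ℝ) (p : L) : Set (E (n + 1)) :=
  {η | ∃ ξ ∈ x.normal p, ∃ m ∈ x.tangent p, (∀ w, ⟪m, x.dx p w⟫ = μ p w) ∧ η = ξ + m}

/-- `V` is tangent, at the point `(p, η)`, to the image of `N^*L + μ` in `Q ≅ T^*S^n`: it is the
velocity of (the image of) a smooth curve `t ↦ (γ t, β t)` in `N^*L + μ` through `(p, η)`. -/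
def IsTangentVector (x : SphereImmersion q n L)
    (μ : ∀ p : L, TangentSpace (𝓡 q) p →L[ℝ] ℝ) (p : L) (η : E (n + 1))
    (V : Fin (n + 1) → ℂ) : Prop :=
  ∃ (γ : ℝ → L) (β : ℝ → E (n + 1)),
    γ 0 = p ∧ β 0 = η ∧
    ContMDiffAt 𝓘(ℝ, ℝ) (𝓡 q) ∞ γ 0 ∧ ContDiffAt ℝ ∞ β 0 ∧
    (∀ᶠ t in 𝓝 (0 : ℝ), β t ∈ x.twistedFibre μ (γ t)) ∧
    HasDerivAt (fun t => toQuadric (x.pt (γ t)) (β t)) V 0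

/-- `N^*L + μ` is Lagrangian: the Kähler form vanishes on it. -/
def IsLagrangian (x : SphereImmersion q n L)
    (μ : ∀ p : L, TangentSpace (𝓡 q) p →L[ℝ] ℝ) : Prop :=
  ∀ p : L, ∀ η ∈ x.twistedFibre μ p, ∀ X Y : Fin (n + 1) → ℂ,
    x.IsTangentVector μ p η X → x.IsTangentVector μ p η Y →
      kahlerForm (toQuadric (x.pt p) η) X Y = 0

/-- `N^*L + μ` is special Lagrangian with phase `exp(iθ)`: it is Lagrangian and
`Im(exp(-iθ) Ω)` vanishes on it. -/
def IsSpecialLagrangianWithPhase (x : SphereImmersion q n L)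
    (μ : ∀ p : L, TangentSpace (𝓡 q) p →L[ℝ] ℝ) (θ : ℝ) : Prop :=
  x.IsLagrangian μ ∧
  ∀ p : L, ∀ η ∈ x.twistedFibre μ p, ∀ V : Fin n → Fin (n + 1) → ℂ,
    (∀ i, x.IsTangentVector μ p η (V i)) →
      (Complex.exp (-(Complex.I * (θ : ℂ))) * holVolForm (toQuadric (x.pt p) η) V).im = 0

/-- `N^*L + μ` is special Lagrangian (with some phase). -/
def IsSpecialLagrangian (x : SphereImmersion q n L)
    (μ : ∀ p : L, TangentSpace (𝓡 q) p →L[ℝ] ℝ) : Prop :=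
  ∃ θ : ℝ, x.IsSpecialLagrangianWithPhase μ θ

end SphereImmersion

/-- Smoothness of a `1`-form on `L`, as a section of the cotangent bundle. -/
def IsSmoothOneForm [IsManifold (𝓡 q) ∞ L] (μ : ∀ p : L, TangentSpace (𝓡 q) p →L[ℝ] ℝ) : Prop :=
  ContMDiff (𝓡 q) ((𝓡 q).prod 𝓘(ℝ, E q →L[ℝ] ℝ)) ∞
    (fun p => Bundle.TotalSpace.mk' (E q →L[ℝ] ℝ)
      (E := fun p : L => TangentSpace (𝓡 q) p →L[ℝ] ℝ) p (μ p))

end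

end StenzelSphere

end

noncomputable section

namespace StenzelSphere

section CharpolyParity
open Polynomial

/-- The roots of a split monic real polynomial are symmetric about `0` iff the polynomial has the
parity of its degree. -/
theorem roots_neg_symmetric_iff {p : ℝ[X]} (hp : p.Monic) (hs : p.Splits) :
    p.roots.map (fun r => -r) = p.roots ↔ (-1) ^ p.natDegree * p.comp (-X) = p := by
  have hC : ((-1) ^ p.natDegree : ℝ[X]) = C ((-1) ^ p.natDegree) := by simp
  have hroots : ((-1) ^ p.natDegree * p.comp (-X)).roots = p.roots.map (fun r => -r) := by
    rw [hC, roots_C_mul _ (by simp), roots_comp_neg_X]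
  constructor
  · intro h
    have hm := hp.neg_one_pow_natDegree_mul_comp_neg_X
    have hs' : ((-1) ^ p.natDegree * p.comp (-X)).Splits := by
      rw [hC]; exact hs.comp_neg_X.C_mul _
    rw [hs'.eq_prod_roots_of_monic hm, hroots, h]
    exact (hs.eq_prod_roots_of_monic hp).symm
  · intro h
    rw [← hroots, h]

theorem det_smul_one_add_smul {q : ℕ} (a : Matrix (Fin q) (Fin q) ℝ) (c : ℝ) {s : ℝ} (hs : s ≠ 0) :
    ((c : ℂ) • (1 : Matrix (Fin q) (Fin q) ℂ) +
      (Complex.I * (s : ℂ)) • a.map Complex.ofReal).det =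
    (s : ℂ) ^ q * ((-Complex.I) ^ q *
      (a.charpoly.map Complex.ofRealHom).eval (Complex.I * ((c / s : ℝ) : ℂ))) := by
  have hs' : (s : ℂ) ≠ 0 := by exact_mod_cast hs
  have h1 : ((c : ℂ) • (1 : Matrix (Fin q) (Fin q) ℂ) +
      (Complex.I * (s : ℂ)) • a.map Complex.ofReal) =
      (-(Complex.I * s)) • (Matrix.scalar (Fin q) (Complex.I * ((c / s : ℝ) : ℂ)) -
        a.map Complex.ofRealHom) := by
    have h2 : -(Complex.I * s) * (Complex.I * ((c / s : ℝ) : ℂ)) = c := by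
      push_cast
      field_simp
      ring_nf
      simp
    rw [smul_sub, ← h2]
    ext i j
    by_cases hij : i = j
    · subst hij; simp
    · simp [hij]
  rw [h1, Matrix.det_smul, ← Matrix.charpoly_map, Matrix.eval_charpoly]
  simp only [Fintype.card_fin]
  rw [show -(Complex.I * (s : ℂ)) = s * (-Complex.I) by ring, mul_pow, mul_assoc]

theorem conj_eval_I_mul (p : ℝ[X]) (y : ℝ) :
    conj ((p.map Complex.ofRealHom).eval (Complex.I * (y : ℂ))) =
      ((p.comp (-X)).map Complex.ofRealHom).eval (Complex.I * (y : ℂ)) := by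
  rw [eval_map, eval_map, eval₂_comp, hom_eval₂]
  congr 1
  · ext r; simp
  · simp

theorem im_eval_eq_zero_iff (p : ℝ[X]) (d : ℕ) (y : ℝ) :
    ((-Complex.I) ^ d * (p.map Complex.ofRealHom).eval (Complex.I * (y : ℂ))).im = 0 ↔
      (((-1) ^ d * p.comp (-X)).map Complex.ofRealHom).eval (Complex.I * (y : ℂ)) =
        (p.map Complex.ofRealHom).eval (Complex.I * (y : ℂ)) := by
  rw [← Complex.conj_eq_iff_im, map_mul, conj_eval_I_mul, map_pow, map_neg, Complex.conj_I, neg_neg]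
  have hI : (-Complex.I) ^ d ≠ 0 := pow_ne_zero _ (by simp)
  rw [show (Complex.I : ℂ) ^ d = (-Complex.I) ^ d * (-1) ^ d by rw [← mul_pow]; simp, mul_assoc,
    mul_right_inj' hI]
  simp

theorem det_im_eq_zero_of_parity {q : ℕ} (a : Matrix (Fin q) (Fin q) ℝ)
    (ha : (-1) ^ q * a.charpoly.comp (-X) = a.charpoly) (c : ℝ) {s : ℝ} (hs : s ≠ 0) :
    ((c : ℂ) • (1 : Matrix (Fin q) (Fin q) ℂ) +
      (Complex.I * (s : ℂ)) • a.map Complex.ofReal).det.im = 0 := by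
  rw [det_smul_one_add_smul a c hs, ← Complex.ofReal_pow, Complex.im_ofReal_mul ,
    (im_eval_eq_zero_iff a.charpoly q (c / s)).2 (by rw [ha]), mul_zero]

theorem parity_of_det_im_eq_zero {q : ℕ} (a : Matrix (Fin q) (Fin q) ℝ) (Y : Set (ℝ × ℝ))
    (hY : ((fun y : ℝ × ℝ => y.1 / y.2) '' Y).Infinite) (hs : ∀ y ∈ Y, y.2 ≠ 0)
    (h : ∀ y ∈ Y, ((y.1 : ℂ) • (1 : Matrix (Fin q) (Fin q) ℂ) +
      (Complex.I * (y.2 : ℂ)) • a.map Complex.ofReal).det.im = 0) :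
    (-1) ^ q * a.charpoly.comp (-X) = a.charpoly := by
  apply Polynomial.map_injective Complex.ofRealHom Complex.ofRealHom.injective
  apply Polynomial.eq_of_infinite_eval_eq
  have hinj : Function.Injective (fun y : ℝ => Complex.I * (y : ℂ)) := fun y z hyz => by
    simpa using hyz
  refine (hY.image hinj.injOn).mono ?_
  rintro _ ⟨_, ⟨y, hy, rfl⟩, rfl⟩
  have h1 := h y hy
  rw [det_smul_one_add_smul a _ (hs y hy), ← Complex.ofReal_pow, Complex.im_ofReal_mul] at h1
  exact (im_eval_eq_zero_iff a.charpoly q _).1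
    ((mul_eq_zero.1 h1).resolve_left (pow_ne_zero _ (hs y hy)))

end CharpolyParity

/-- The image of `(a, b)` under the differential at `(x, η)` of
`(x, η) ↦ c x + i s η`, where the functions `c`, `s` of `|η|` have
`dc = s ⟪η, b⟫` and `ds = s₁ ⟪η, b⟫`. -/
def pushforward {n : ℕ} (c s s₁ : ℝ) (x η a b : E (n + 1)) : Fin (n + 1) → ℂ := fun k =>
  ((c * a k + s * ⟪η, b⟫ * x k : ℝ) : ℂ) +
    Complex.I * ((s * b k + s₁ * ⟪η, b⟫ * η k : ℝ) : ℂ)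

section Determinant

variable {q n : ℕ} {x : E (n + 1)} {d : E q →ₗ[ℝ] E (n + 1)} {N : Submodule ℝ (E (n + 1))}

theorem eq_zero_of_tangent_add_normal (hx : ⟪x, x⟫ = 1) (hxd : ∀ w, ⟪x, d w⟫ = 0)
    (hd : Function.Injective d)
    (hN : ∀ v, v ∈ N ↔ ⟪x, v⟫ = 0 ∧ ∀ w, ⟪d w, v⟫ = 0) {w : E q} {c : ℝ} {ν : E (n + 1)}
    (hν : ν ∈ N) (h : d w + (c • x + ν) = 0) : w = 0 ∧ c = 0 ∧ ν = 0 := by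
  obtain ⟨h1, h2⟩ := (hN ν).1 hν
  have hc : c = 0 := by
    have := congrArg (fun v => ⟪x, v⟫) h
    simpa only [inner_add_right, inner_smul_right, hxd, hx, h1, inner_zero_right, mul_one, zero_add,
      add_zero] using this
  subst hc
  have hw : d w = 0 := by
    have := congrArg (fun v => ⟪d w, v⟫) h
    simpa [inner_add_right, h2] using this
  refine ⟨hd (by simpa using hw), rfl, by simpa [hw] using h⟩

theorem exists_tangent_add_normal (hx : ⟪x, x⟫ = 1) (hxd : ∀ w, ⟪x, d w⟫ = 0)
    (hN : ∀ v, v ∈ N ↔ ⟪x, v⟫ = 0 ∧ ∀ w, ⟪d w, v⟫ = 0) (v : E (n + 1)) :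
    ∃ w, ∃ ν ∈ N, v = d w + (⟪x, v⟫ • x + ν) := by
  obtain ⟨t, ht, m, hm, hv⟩ := (LinearMap.range d).exists_add_mem_mem_orthogonal v
  obtain ⟨w, rfl⟩ := ht
  refine ⟨w, m - ⟪x, v⟫ • x, (hN _).2 ⟨?_, fun u => ?_⟩, by rw [hv]; abel⟩
  · rw [inner_sub_right, inner_smul_right, hx, hv, inner_add_right, hxd]; ring
  · rw [inner_sub_right, inner_smul_right, real_inner_comm x, hxd, mul_zero, sub_zero]
    exact (Submodule.mem_orthogonal _ _).1 hm _ ⟨u, rfl⟩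

/-- The splitting `ℝ^{n+1} = T_p L ⊕ ℝ x ⊕ N_p L`. -/
def splitting (hx : ⟪x, x⟫ = 1) (hxd : ∀ w, ⟪x, d w⟫ = 0) (hd : Function.Injective d)
    (hN : ∀ v, v ∈ N ↔ ⟪x, v⟫ = 0 ∧ ∀ w, ⟪d w, v⟫ = 0) : (E q × ℝ × N) ≃ₗ[ℝ] E (n + 1) :=
  LinearEquiv.ofBijective
    (d.coprod ((LinearMap.toSpanSingleton ℝ _ x).coprod N.subtype)) (by
      constructor
      · rw [← LinearMap.ker_eq_bot, LinearMap.ker_eq_bot']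
        rintro ⟨w, c, ν⟩ h
        obtain ⟨h1, h2, h3⟩ := eq_zero_of_tangent_add_normal hx hxd hd hN ν.2
          (by simpa using h : d w + (c • x + (ν : E (n + 1))) = 0)
        simp [h1, h2, Submodule.coe_eq_zero.1 h3]
      · intro v
        obtain ⟨w, ν, hν, h⟩ := exists_tangent_add_normal hx hxd hN v
        exact ⟨(w, ⟪x, v⟫, ⟨ν, hν⟩), by simpa using h.symm⟩)

@[simp]
theorem splitting_apply (hx : ⟪x, x⟫ = 1) (hxd : ∀ w, ⟪x, d w⟫ = 0) (hd : Function.Injective d)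
    (hN : ∀ v, v ∈ N ↔ ⟪x, v⟫ = 0 ∧ ∀ w, ⟪d w, v⟫ = 0) (u : E q × ℝ × N) :
    splitting hx hxd hd hN u = d u.1 + (u.2.1 • x + (u.2.2 : E (n + 1))) := rfl

theorem finrank_normal (hx : ⟪x, x⟫ = 1) (hxd : ∀ w, ⟪x, d w⟫ = 0) (hd : Function.Injective d)
    (hN : ∀ v, v ∈ N ↔ ⟪x, v⟫ = 0 ∧ ∀ w, ⟪d w, v⟫ = 0) : q + Module.finrank ℝ N = n := by
  have := (splitting hx hxd hd hN).finrank_eq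
  simp only [Module.finrank_prod, Module.finrank_self, finrank_euclideanSpace_fin] at this
  omega

/-- Index set of a basis of `ℝ^{n+1}` adapted to `T_p L ⊕ ℝ x ⊕ N_p L`. -/
abbrev AdaptedIndex (q : ℕ) (N : Submodule ℝ (E (n + 1))) : Type :=
  Fin q ⊕ (Unit ⊕ Fin (Module.finrank ℝ N))

/-- A basis of `ℝ^{n+1}` adapted to `T_p L ⊕ ℝ x ⊕ N_p L`. -/
def adaptedBasis (hx : ⟪x, x⟫ = 1) (hxd : ∀ w, ⟪x, d w⟫ = 0) (hd : Function.Injective d)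
    (hN : ∀ v, v ∈ N ↔ ⟪x, v⟫ = 0 ∧ ∀ w, ⟪d w, v⟫ = 0) :
    Module.Basis (AdaptedIndex q N) ℝ (E (n + 1)) :=
  (((EuclideanSpace.basisFun (Fin q) ℝ).toBasis.prod
    ((Module.Basis.singleton Unit ℝ).prod (stdOrthonormalBasis ℝ N).toBasis)).map
      (splitting hx hxd hd hN))

theorem adaptedBasis_tangent (hx : ⟪x, x⟫ = 1) (hxd : ∀ w, ⟪x, d w⟫ = 0) (hd : Function.Injective d)
    (hN : ∀ v, v ∈ N ↔ ⟪x, v⟫ = 0 ∧ ∀ w, ⟪d w, v⟫ = 0) (i : Fin q) :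
    adaptedBasis hx hxd hd hN (Sum.inl i) = d (EuclideanSpace.single i 1) := by
  simp [adaptedBasis]

theorem adaptedBasis_point (hx : ⟪x, x⟫ = 1) (hxd : ∀ w, ⟪x, d w⟫ = 0) (hd : Function.Injective d)
    (hN : ∀ v, v ∈ N ↔ ⟪x, v⟫ = 0 ∧ ∀ w, ⟪d w, v⟫ = 0) (i : Unit) :
    adaptedBasis hx hxd hd hN (Sum.inr (Sum.inl i)) = x := by
  simp [adaptedBasis]

theorem adaptedBasis_normal (hx : ⟪x, x⟫ = 1) (hxd : ∀ w, ⟪x, d w⟫ = 0) (hd : Function.Injective d)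
    (hN : ∀ v, v ∈ N ↔ ⟪x, v⟫ = 0 ∧ ∀ w, ⟪d w, v⟫ = 0) (i : Fin (Module.finrank ℝ N)) :
    adaptedBasis hx hxd hd hN (Sum.inr (Sum.inr i)) = stdOrthonormalBasis ℝ N i := by
  simp [adaptedBasis]

/-- The bordered matrix of the fibre directions of `T^*S^n` in an adapted basis is nonsingular. -/
theorem det_bordered_ne_zero {m : ℕ} (g : Fin m → ℝ) {c s s₁ : ℝ} (hs : s ≠ 0)
    (h1 : s + s₁ * (g ⬝ᵥ g) = c) (h2 : c ^ 2 - s ^ 2 * (g ⬝ᵥ g) = 1) :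
    (Matrix.fromBlocks (Matrix.of fun _ _ : Unit => c) (Matrix.of fun _ k => s * g k)
      (Matrix.of fun k _ => s * g k)
      (s • (1 : Matrix (Fin m) (Fin m) ℝ) + s₁ • Matrix.vecMulVec g g)).det ≠ 0 := by
  intro hdet
  obtain ⟨v, hv0, hv⟩ := Matrix.exists_mulVec_eq_zero_iff.2 hdet
  apply hv0
  set κ := g ⬝ᵥ (v ∘ Sum.inr) with hκ
  set c0 := v (Sum.inl ()) with hc0
  have e1 : c * c0 + s * κ = 0 := by
    have := congrFun hv (Sum.inl ())
    rw [Matrix.fromBlocks_mulVec] at this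
    simpa [Matrix.mulVec, dotProduct, mul_assoc, ← Finset.mul_sum, hκ] using this
  have e2 : ∀ k, s * g k * c0 + (s * v (Sum.inr k) + s₁ * (g k * κ)) = 0 := by
    intro k
    have := congrFun hv (Sum.inr k)
    rw [Matrix.fromBlocks_mulVec] at this
    simpa [Matrix.mulVec, dotProduct, mul_assoc, ← Finset.mul_sum, hκ, add_mul,
      Finset.sum_add_distrib, Matrix.one_apply, Matrix.vecMulVec_apply, -mul_eq_mul_left_iff] using this
  have e3 : s * (g ⬝ᵥ g) * c0 + (s * κ + s₁ * ((g ⬝ᵥ g) * κ)) = 0 := by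
    have : ∑ k, g k * (s * g k * c0 + (s * v (Sum.inr k) + s₁ * (g k * κ))) = 0 :=
      Finset.sum_eq_zero fun k _ => by rw [e2, mul_zero]
    rw [← this, Finset.sum_congr rfl fun k _ => show
      g k * (s * g k * c0 + (s * v (Sum.inr k) + s₁ * (g k * κ))) =
        s * c0 * (g k * g k) + s * (g k * v (Sum.inr k)) + s₁ * κ * (g k * g k) by ring,
      Finset.sum_add_distrib, Finset.sum_add_distrib, ← Finset.mul_sum, ← Finset.mul_sum,
      ← Finset.mul_sum]
    change _ = s * c0 * (g ⬝ᵥ g) + s * κ + s₁ * κ * (g ⬝ᵥ g)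
    ring
  have e4 : s * (g ⬝ᵥ g) * c0 + c * κ = 0 := by rw [← h1]; linarith
  have hc : c0 = 0 := by linear_combination c * e1 - s * e4 - c0 * h2
  have hk : κ = 0 := by linear_combination c * e4 - s * (g ⬝ᵥ g) * e1 - κ * h2
  funext i
  rcases i with ⟨⟩ | k
  · exact hc
  · have := e2 k
    simp only [hc, hk, mul_zero, zero_add, add_zero] at this
    exact (mul_eq_zero.1 this).resolve_left hs


theorem pushforward_add {c s s₁ : ℝ} {η a b a' b' : E (n + 1)} :
    pushforward c s s₁ x η (a + a') (b + b') =
      pushforward c s s₁ x η a b + pushforward c s s₁ x η a' b' := by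
  funext k
  simp only [pushforward, Pi.add_apply, PiLp.add_apply, inner_add_right]
  push_cast
  ring

theorem pushforward_smul {c s s₁ t : ℝ} {η a b : E (n + 1)} :
    pushforward c s s₁ x η (t • a) (t • b) = (t : ℂ) • pushforward c s s₁ x η a b := by
  funext k
  simp only [pushforward, Pi.smul_apply, PiLp.smul_apply, inner_smul_right, smul_eq_mul]
  push_cast
  ring

/-- `pushforward`, as a linear map. -/
def pushforwardₗ (c s s₁ : ℝ) (x η : E (n + 1)) :
    (E (n + 1) × E (n + 1)) →ₗ[ℝ] (Fin (n + 1) → ℂ) where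
  toFun u := pushforward c s s₁ x η u.1 u.2
  map_add' u v := pushforward_add
  map_smul' t u := by
    change pushforward c s s₁ x η (t • u.1) (t • u.2) = _
    rw [pushforward_smul]; funext k; simp

/-- The images of the adapted basis in `T Q`, together with the position vector. -/
def adaptedImage (c s s₁ : ℝ) (x : E (n + 1)) (d : E q →ₗ[ℝ] E (n + 1))
    (N : Submodule ℝ (E (n + 1))) (A : E q →ₗ[ℝ] E q) (ξ : E (n + 1)) :
    Matrix (AdaptedIndex q N) (Fin (n + 1)) ℂ :=
  Sum.elim (fun i => pushforward c s s₁ x ξ (d (EuclideanSpace.single i 1))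
      (d (A (EuclideanSpace.single i 1))))
    (Sum.elim (fun _ k => ((c * x k : ℝ) : ℂ) + Complex.I * ((s * ξ k : ℝ) : ℂ))
      (fun k => pushforward c s s₁ x ξ 0 (stdOrthonormalBasis ℝ N k)))

/-- The real coefficients of a tuple of tangent vectors and the position vector. -/
def coefficientMatrix (N : Submodule ℝ (E (n + 1))) (w : Fin n → E q) (ν : Fin n → N) :
    Matrix (Fin (n + 1)) (AdaptedIndex q N) ℝ :=
  Fin.cons (Pi.single (Sum.inr (Sum.inl ())) 1)
    (fun j => Sum.elim (w j) (Sum.elim 0 ((stdOrthonormalBasis ℝ N).repr (ν j))))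

theorem coefficientMatrix_zero (N : Submodule ℝ (E (n + 1))) (w : Fin n → E q) (ν : Fin n → N) :
    coefficientMatrix N w ν 0 = Pi.single (Sum.inr (Sum.inl ())) 1 := rfl

theorem coefficientMatrix_succ (N : Submodule ℝ (E (n + 1))) (w : Fin n → E q) (ν : Fin n → N)
    (j : Fin n) : coefficientMatrix N w ν j.succ =
      Sum.elim (w j) (Sum.elim 0 ((stdOrthonormalBasis ℝ N).repr (ν j))) := rfl

theorem cons_eq_coefficientMatrix_mul (c s s₁ : ℝ) (A : E q →ₗ[ℝ] E q) (ξ : E (n + 1))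
    (w : Fin n → E q) (ν : Fin n → N) :
    (Matrix.of (Fin.cons (fun k => ((c * x k : ℝ) : ℂ) + Complex.I * ((s * ξ k : ℝ) : ℂ))
      (fun j => pushforward c s s₁ x ξ (d (w j)) (d (A (w j)) + (ν j : E (n + 1)))) :
        Fin (n + 1) → Fin (n + 1) → ℂ)) =
    (coefficientMatrix N w ν).map Complex.ofReal * adaptedImage c s s₁ x d N A ξ := by
  ext j k
  rw [Matrix.mul_apply]
  refine Fin.cases ?_ (fun j => ?_) j
  · simp only [Matrix.map_apply, coefficientMatrix_zero]
    simp [adaptedImage, Pi.single_apply]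
  · have hw : w j = ∑ i, w j i • EuclideanSpace.single i (1 : ℝ) := by
      simpa using ((EuclideanSpace.basisFun (Fin q) ℝ).sum_repr (w j)).symm
    have hν : (ν j : E (n + 1)) = ∑ i, (stdOrthonormalBasis ℝ N).repr (ν j) i •
        (stdOrthonormalBasis ℝ N i : E (n + 1)) := by
      conv_lhs => rw [← (stdOrthonormalBasis ℝ N).sum_repr (ν j)]
      simp
    have h : pushforward c s s₁ x ξ (d (w j)) (d (A (w j)) + (ν j : E (n + 1))) =
        ∑ i, w j i • pushforward c s s₁ x ξ (d (EuclideanSpace.single i 1))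
          (d (A (EuclideanSpace.single i 1))) +
        ∑ i, (stdOrthonormalBasis ℝ N).repr (ν j) i •
          pushforward c s s₁ x ξ 0 (stdOrthonormalBasis ℝ N i) := by
      change _ = ∑ i, w j i • pushforwardₗ c s s₁ x ξ (d (EuclideanSpace.single i 1),
          (d (A (EuclideanSpace.single i 1)))) + ∑ i, (stdOrthonormalBasis ℝ N).repr (ν j) i •
          pushforwardₗ c s s₁ x ξ (0, (stdOrthonormalBasis ℝ N i : E (n + 1)))
      simp only [← map_smul, ← map_sum, ← map_add]
      change pushforwardₗ c s s₁ x ξ (d (w j), d (A (w j)) + (ν j : E (n + 1))) = _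
      congr 1
      refine Prod.ext ?_ ?_
      · simp only [Prod.fst_add, Prod.fst_sum, Prod.smul_fst, smul_zero, Finset.sum_const_zero,
          add_zero]
        conv_lhs => rw [hw]
        simp
      · simp only [Prod.snd_add, Prod.snd_sum, Prod.smul_snd]
        rw [← hν]
        conv_lhs => rw [hw]
        simp
    simp only [Matrix.of_apply, Fin.cons_succ, h]
    simp only [Matrix.map_apply, coefficientMatrix_succ]
    simp [adaptedImage, Fintype.sum_sum_type]

/-- The matrix of the differential of `(x, ξ) ↦ c x + i s ξ` along the conormal bundle, in an
adapted basis. -/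
def adaptedMatrix (c s s₁ : ℝ) (N : Submodule ℝ (E (n + 1))) (A : E q →ₗ[ℝ] E q)
    (g : Fin (Module.finrank ℝ N) → ℝ) : Matrix (AdaptedIndex q N) (AdaptedIndex q N) ℂ :=
  Matrix.fromBlocks
    ((c : ℂ) • (1 : Matrix (Fin q) (Fin q) ℂ) + (Complex.I * (s : ℂ)) •
      (LinearMap.toMatrix (EuclideanSpace.basisFun (Fin q) ℝ).toBasis
        (EuclideanSpace.basisFun (Fin q) ℝ).toBasis A).map Complex.ofReal).transpose 0 0
    ((Matrix.fromBlocks (Matrix.of fun _ _ : Unit => c) (Matrix.of fun _ k => s * g k)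
      (Matrix.of fun k _ => s * g k)
      (s • (1 : Matrix _ _ ℝ) + s₁ • Matrix.vecMulVec g g)).map Complex.ofReal *
      Matrix.diagonal (Sum.elim 1 fun _ => Complex.I))

theorem adaptedImage_eq (hx : ⟪x, x⟫ = 1) (hxd : ∀ w, ⟪x, d w⟫ = 0) (hd : Function.Injective d)
    (hN : ∀ v, v ∈ N ↔ ⟪x, v⟫ = 0 ∧ ∀ w, ⟪d w, v⟫ = 0) (c s s₁ : ℝ) (A : E q →ₗ[ℝ] E q) (ξ : N) :
    adaptedImage c s s₁ x d N A ξ =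
      adaptedMatrix c s s₁ N A ((stdOrthonormalBasis ℝ N).repr ξ) *
      Matrix.of fun i k => ((adaptedBasis hx hxd hd hN i k : ℝ) : ℂ) := by
  have hξ : ∀ k, (ξ : E (n + 1)) k = ∑ i, (stdOrthonormalBasis ℝ N).repr ξ i *
        (stdOrthonormalBasis ℝ N i : E (n + 1)) k := by
    intro k
    conv_lhs => rw [← (stdOrthonormalBasis ℝ N).sum_repr ξ]
    simp
  have hdξ : ∀ w, ⟪(ξ : E (n + 1)), d w⟫ = 0 := fun w => by
    rw [real_inner_comm]; exact ((hN _).1 ξ.2).2 w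
  have hνξ : ∀ k, ⟪(ξ : E (n + 1)), (stdOrthonormalBasis ℝ N k : E (n + 1))⟫ =
      (stdOrthonormalBasis ℝ N).repr ξ k := fun k => by
    rw [OrthonormalBasis.repr_apply_apply, real_inner_comm]; rfl
  ext i k
  rw [Matrix.mul_apply]
  rcases i with i | ⟨⟩ | i
  · have hA : d (A (EuclideanSpace.single i 1)) =
        ∑ l, A (EuclideanSpace.single i 1) l • d (EuclideanSpace.single l 1) := by
      simp only [← map_smul, ← map_sum]
      congr 1
      simpa using ((EuclideanSpace.basisFun (Fin q) ℝ).sum_repr (A (EuclideanSpace.single i 1))).symm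
    simp only [adaptedImage, Sum.elim_inl, pushforward, hdξ]
    rw [hA]
    simp [Fintype.sum_sum_type, adaptedMatrix, adaptedBasis_tangent, Matrix.one_apply,
      LinearMap.toMatrix_apply, add_mul, Finset.sum_add_distrib, Finset.mul_sum, mul_assoc]
  · simp [Fintype.sum_sum_type, adaptedImage, adaptedMatrix, adaptedBasis_point,
      adaptedBasis_normal, hξ, Finset.mul_sum]
    exact Finset.sum_congr rfl fun i _ => by ring
  · simp [Fintype.sum_sum_type, adaptedImage, adaptedMatrix, adaptedBasis_point,
      adaptedBasis_normal, pushforward, hνξ]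
    simp only [Matrix.one_apply, Matrix.vecMulVec_apply, add_mul, Finset.sum_add_distrib, mul_add]
    congr 1
    · rw [Finset.sum_eq_single i (fun j _ hj => by simp [hj.symm]) (by simp)]
      simp only [if_true, Complex.ofReal_one]
      ring
    · simp only [hξ, Complex.ofReal_sum, Finset.mul_sum, Complex.ofReal_mul]
      exact Finset.sum_congr rfl fun i _ => by ring

theorem det_map_ofReal {ι : Type*} [Fintype ι] [DecidableEq ι] (M : Matrix ι ι ℝ) :
    (M.map Complex.ofReal).det = (M.det : ℂ) :=
  (Complex.ofRealHom.map_det M).symm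

theorem det_adaptedMatrix (c s s₁ : ℝ) (N : Submodule ℝ (E (n + 1))) (A : E q →ₗ[ℝ] E q)
    (g : Fin (Module.finrank ℝ N) → ℝ) (hs : s ≠ 0)
    (h1 : s + s₁ * (g ⬝ᵥ g) = c) (h2 : c ^ 2 - s ^ 2 * (g ⬝ᵥ g) = 1) :
    ∃ K : ℝ, K ≠ 0 ∧ (adaptedMatrix c s s₁ N A g).det = (K : ℂ) *
      (Complex.I ^ Module.finrank ℝ N * ((c : ℂ) • (1 : Matrix (Fin q) (Fin q) ℂ) +
      (Complex.I * (s : ℂ)) • (LinearMap.toMatrix (EuclideanSpace.basisFun (Fin q) ℝ).toBasis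
        (EuclideanSpace.basisFun (Fin q) ℝ).toBasis A).map Complex.ofReal).det) := by
  refine ⟨_, det_bordered_ne_zero g hs h1 h2, ?_⟩
  rw [adaptedMatrix, Matrix.det_fromBlocks_zero₂₁, Matrix.det_transpose, Matrix.det_mul,
    Matrix.det_diagonal, det_map_ofReal]
  simp only [Fintype.prod_sum_type, Sum.elim_inl, Sum.elim_inr, Pi.one_apply, Finset.prod_const_one,
    one_mul, Finset.prod_const, Finset.card_univ, Fintype.card_fin]
  ring

/-- The value of the holomorphic volume form on vectors tangent to the conormal bundle. -/
theorem holVolForm_pushforward (hx : ⟪x, x⟫ = 1) (hxd : ∀ w, ⟪x, d w⟫ = 0)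
    (hd : Function.Injective d) (hN : ∀ v, v ∈ N ↔ ⟪x, v⟫ = 0 ∧ ∀ w, ⟪d w, v⟫ = 0) {c s s₁ : ℝ}
    (A : E q →ₗ[ℝ] E q) (ξ : N) (hs : s ≠ 0) (h1 : s + s₁ * ⟪(ξ : E (n + 1)), ξ⟫ = c)
    (h2 : c ^ 2 - s ^ 2 * ⟪(ξ : E (n + 1)), ξ⟫ = 1) :
    ∃ ρ : (Fin n → E q) → (Fin n → N) → ℝ, (∃ w ν, ρ w ν ≠ 0) ∧ ∀ w ν,
      holVolForm (fun k => ((c * x k : ℝ) : ℂ) + Complex.I * ((s * (ξ : E (n + 1)) k : ℝ) : ℂ))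
        (fun j => pushforward c s s₁ x ξ (d (w j)) (d (A (w j)) + (ν j : E (n + 1)))) =
      (ρ w ν : ℂ) * (Complex.I ^ (n - q) * ((c : ℂ) • (1 : Matrix (Fin q) (Fin q) ℂ) +
        (Complex.I * (s : ℂ)) • (LinearMap.toMatrix (EuclideanSpace.basisFun (Fin q) ℝ).toBasis
          (EuclideanSpace.basisFun (Fin q) ℝ).toBasis A).map Complex.ofReal).det) := by
  have hm : n - q = Module.finrank ℝ N := by have := finrank_normal hx hxd hd hN; omega
  set g : Fin (Module.finrank ℝ N) → ℝ := ((stdOrthonormalBasis ℝ N).repr ξ).ofLp with hg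
  have hgg : g ⬝ᵥ g = ⟪(ξ : E (n + 1)), ξ⟫ := by
    rw [← Submodule.coe_inner, ← (stdOrthonormalBasis ℝ N).repr.inner_map_map]
    rw [PiLp.inner_apply]
    simp only [dotProduct, hg, RCLike.inner_apply, conj_trivial]
  obtain ⟨K, hK, hdet⟩ := det_adaptedMatrix c s s₁ N A g hs (by rw [hgg, h1]) (by rw [hgg, h2])
  let bb := adaptedBasis hx hxd hd hN
  have hcard : Fintype.card (Fin (n + 1)) = Fintype.card (AdaptedIndex q N) := by
    rw [← Module.finrank_eq_card_basis bb]; simp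
  obtain ⟨e, he⟩ : ∃ e : Fin (n + 1) ≃ AdaptedIndex q N, e 0 = Sum.inr (Sum.inl ()) :=
    ⟨(Fintype.equivOfCardEq hcard).trans (Equiv.swap _ (Sum.inr (Sum.inl ()))),
      Equiv.swap_apply_left _ _⟩
  let B : Matrix (AdaptedIndex q N) (Fin (n + 1)) ℝ := Matrix.of fun i k => bb i k
  have hB : (B.submatrix e id).det ≠ 0 := by
    have h := ((EuclideanSpace.basisFun (Fin (n + 1)) ℝ).toBasis.isUnit_det
      (bb.reindex e.symm)).ne_zero
    rw [Module.Basis.det_apply, ← Matrix.det_transpose] at h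
    convert h using 2
    ext i k
    simp [B, Module.Basis.toMatrix_apply]
  refine ⟨fun w ν => ((coefficientMatrix N w ν).submatrix id e).det *
    (K * (B.submatrix e id).det), ?_, fun w ν => ?_⟩
  · refine ⟨fun j => Sum.elim (fun i => EuclideanSpace.single i 1) (fun _ => 0) (e j.succ),
      fun j => Sum.elim (fun _ => 0) (Sum.elim (fun _ => 0) (stdOrthonormalBasis ℝ N)) (e j.succ),
      ?_⟩
    refine mul_ne_zero ?_ (mul_ne_zero hK hB)
    convert one_ne_zero (α := ℝ)
    convert Matrix.det_one (n := Fin (n + 1)) (R := ℝ)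
    ext j k
    refine Fin.cases ?_ (fun j => ?_) j
    · rw [Matrix.submatrix_apply, id, coefficientMatrix_zero, ← he, Pi.single_apply,
        Matrix.one_apply]
      simp [eq_comm]
    · have hj : e j.succ ≠ Sum.inr (Sum.inl ()) := by
        rw [← he]; exact fun h => Fin.succ_ne_zero j (e.injective h)
      rw [Matrix.submatrix_apply, id, coefficientMatrix_succ, Matrix.one_apply,
        show (if j.succ = k then (1 : ℝ) else 0) = if e j.succ = e k then 1 else 0 by
          simp [e.injective.eq_iff]]
      generalize e j.succ = a at hj
      generalize e k = b
      rcases a with a | ⟨⟨⟩⟩ | a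
      · rcases b with b | ⟨⟨⟩⟩ | b <;> simp [eq_comm, Pi.single_apply]
      · exact absurd rfl hj
      · rcases b with b | ⟨⟨⟩⟩ | b <;> simp [eq_comm, Pi.single_apply]
  · rw [holVolForm, cons_eq_coefficientMatrix_mul, adaptedImage_eq hx hxd hd hN, ← hg, hm]
    have hsub : (coefficientMatrix N w ν).map Complex.ofReal * (adaptedMatrix c s s₁ N A g *
        Matrix.of fun i k => ((adaptedBasis hx hxd hd hN i k : ℝ) : ℂ)) =
        ((coefficientMatrix N w ν).submatrix id e).map Complex.ofReal *
          ((adaptedMatrix c s s₁ N A g).submatrix e e * (B.submatrix e id).map Complex.ofReal) := by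
      rw [← Matrix.submatrix_map, ← Matrix.submatrix_map, Matrix.submatrix_mul_equiv,
        Matrix.submatrix_mul_equiv, Matrix.submatrix_id_id]
      rfl
    rw [hsub, Matrix.det_mul, Matrix.det_mul, Matrix.det_submatrix_equiv_self, hdet,
      det_map_ofReal, det_map_ofReal]
    push_cast
    ring

end Determinant

section Profile

theorem sinh_lt_mul_cosh {t : ℝ} (ht : 0 < t) : Real.sinh t < t * Real.cosh t := by
  have hmono : StrictMonoOn (fun t => t * Real.cosh t - Real.sinh t) (Set.Ici 0) := by
    apply strictMonoOn_of_deriv_pos (convex_Ici 0) (by fun_prop)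
    intro u hu
    rw [interior_Ici, Set.mem_Ioi] at hu
    have h : HasDerivAt (fun t => t * Real.cosh t - Real.sinh t)
        (1 * Real.cosh u + u * Real.sinh u - Real.cosh u) u :=
      ((hasDerivAt_id u).mul (Real.hasDerivAt_cosh u)).sub (Real.hasDerivAt_sinh u)
    rw [h.deriv]
    have := mul_pos hu (Real.sinh_pos_iff.2 hu)
    linarith
  have := hmono Set.self_mem_Ici ht.le ht
  simpa using this

/-- `f'(t) ^ n`. -/
def profilePow (n : ℕ) (t : ℝ) : ℝ := (n : ℝ) * ∫ σ in (0 : ℝ)..t, Real.sinh σ ^ (n - 1)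

theorem hasDerivAt_profilePow (n : ℕ) (t : ℝ) :
    HasDerivAt (profilePow n) ((n : ℝ) * Real.sinh t ^ (n - 1)) t := by
  have hc : Continuous fun σ : ℝ => Real.sinh σ ^ (n - 1) := by fun_prop
  exact (intervalIntegral.integral_hasDerivAt_right (hc.intervalIntegrable _ _)
    (hc.stronglyMeasurableAtFilter _ _) hc.continuousAt).const_mul _

theorem profilePow_pos {n : ℕ} (hn : n ≠ 0) {t : ℝ} (ht : 0 < t) : 0 < profilePow n t := by
  refine mul_pos (by positivity) (intervalIntegral.intervalIntegral_pos_of_pos_on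
    (Continuous.intervalIntegrable (by fun_prop) _ _) (fun u hu => ?_) ht)
  have := Real.sinh_pos_iff.2 hu.1
  positivity

theorem profilePow_lt {n : ℕ} (hn : 2 ≤ n) {t : ℝ} (ht : 0 < t) :
    profilePow n t < t * Real.sinh t ^ (n - 1) := by
  obtain ⟨k, rfl⟩ := Nat.exists_eq_add_of_le' hn
  have hd : ∀ u, HasDerivAt (fun t => t * Real.sinh t ^ (k + 1) - profilePow (k + 2) t)
      ((k + 1) * Real.sinh u ^ k * (u * Real.cosh u - Real.sinh u)) u := by
    intro u
    refine (((hasDerivAt_id u).mul ((Real.hasDerivAt_sinh u).pow (k + 1))).sub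
      (hasDerivAt_profilePow (k + 2) u)).congr_deriv ?_
    push_cast
    simp only [id, Pi.pow_apply]
    ring
  have hmono : StrictMonoOn (fun t => t * Real.sinh t ^ (k + 1) - profilePow (k + 2) t)
      (Set.Ici 0) := by
    apply strictMonoOn_of_deriv_pos (convex_Ici 0)
      (fun u _ => (hd u).continuousAt.continuousWithinAt)
    intro u hu
    rw [interior_Ici, Set.mem_Ioi] at hu
    rw [(hd u).deriv]
    have h1 := sub_pos.2 (sinh_lt_mul_cosh hu)
    have h2 := Real.sinh_pos_iff.2 hu
    positivity
  have := hmono Set.self_mem_Ici ht.le ht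
  simp only [zero_mul, zero_sub] at this
  have h0 : profilePow (k + 2) 0 = 0 := by simp [profilePow]
  rw [h0] at this
  change _ < t * Real.sinh t ^ (k + 1)
  linarith

theorem profileSlope_eq (n : ℕ) (t : ℝ) : profileSlope n t = profilePow n t ^ (1 / (n : ℝ)) := rfl

theorem continuous_profileSlope (n : ℕ) : Continuous (profileSlope n) := by
  have h : Continuous (profilePow n) :=
    continuous_iff_continuousAt.2 fun t => (hasDerivAt_profilePow n t).continuousAt
  exact h.rpow_const fun t => Or.inr (by positivity)

theorem hasDerivAt_profile (n : ℕ) (t : ℝ) : HasDerivAt (profile n) (profileSlope n t) t :=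
  intervalIntegral.integral_hasDerivAt_right ((continuous_profileSlope n).intervalIntegrable _ _)
    ((continuous_profileSlope n).stronglyMeasurableAtFilter _ _) (continuous_profileSlope n).continuousAt

/-- `f''(t)`. -/
def profileSlopeDeriv (n : ℕ) (t : ℝ) : ℝ :=
  Real.sinh t ^ (n - 1) * profilePow n t ^ (1 / (n : ℝ) - 1)

theorem hasDerivAt_profileSlope {n : ℕ} (hn : n ≠ 0) {t : ℝ} (ht : 0 < t) :
    HasDerivAt (profileSlope n) (profileSlopeDeriv n t) t := by
  refine ((hasDerivAt_profilePow n t).rpow_const (p := 1 / (n : ℝ))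
    (Or.inl (profilePow_pos hn ht).ne')).congr_deriv ?_
  rw [profileSlopeDeriv]
  field_simp

theorem profileSlope_div_lt {n : ℕ} (hn : 2 ≤ n) {t : ℝ} (ht : 0 < t) :
    profileSlope n t / t < profileSlopeDeriv n t := by
  have hp := profilePow_pos (by omega : n ≠ 0) ht
  rw [div_lt_iff₀ ht, profileSlopeDeriv, profileSlope_eq,
    show 1 / (n : ℝ) = 1 + (1 / (n : ℝ) - 1) by ring, Real.rpow_add hp, Real.rpow_one,
    show 1 + (1 / (n : ℝ) - 1) - 1 = 1 / (n : ℝ) - 1 by ring]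
  have := mul_lt_mul_of_pos_right (profilePow_lt hn ht) (Real.rpow_pos_of_pos hp (1 / (n : ℝ) - 1))
  linarith

theorem potentialDeriv_eq (n : ℕ) {w : ℝ} (hw : 1 < w) :
    potentialDeriv n w = profileSlope n (Real.arcosh w) * (√(w ^ 2 - 1))⁻¹ := by
  rw [potentialDeriv, derivWithin_of_mem_nhds (Ici_mem_nhds hw)]
  exact ((hasDerivAt_profile n _).comp w (Real.hasDerivAt_arcosh hw)).deriv

theorem potentialDeriv_cosh (n : ℕ) {t : ℝ} (ht : 0 < t) :
    potentialDeriv n (Real.cosh t) = profileSlope n t / Real.sinh t := by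
  rw [potentialDeriv_eq n (Real.one_lt_cosh.2 ht.ne'), Real.arcosh_cosh ht.le, ← Real.sinh_sq,
    Real.sqrt_sq (Real.sinh_nonneg_iff.2 ht.le), div_eq_mul_inv]

theorem potentialDeriv2_cosh {n : ℕ} (hn : n ≠ 0) {t : ℝ} (ht : 0 < t) :
    potentialDeriv2 n (Real.cosh t) =
      (profileSlopeDeriv n t - profileSlope n t * Real.cosh t / Real.sinh t) /
        Real.sinh t ^ 2 := by
  have hw : 1 < Real.cosh t := Real.one_lt_cosh.2 ht.ne'
  have hs := Real.sinh_pos_iff.2 ht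
  rw [potentialDeriv2, derivWithin_of_mem_nhds (Ici_mem_nhds hw)]
  have h1 : potentialDeriv n =ᶠ[𝓝 (Real.cosh t)]
      fun w => profileSlope n (Real.arcosh w) * (√(w ^ 2 - 1))⁻¹ := by
    filter_upwards [Ioi_mem_nhds hw] with w hw using potentialDeriv_eq n hw
  rw [h1.deriv_eq]
  have hsq : √(Real.cosh t ^ 2 - 1) = Real.sinh t := by
    rw [← Real.sinh_sq, Real.sqrt_sq hs.le]
  have h2 : HasDerivAt (fun w : ℝ => √(w ^ 2 - 1)) (2 * Real.cosh t / (2 * Real.sinh t))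
      (Real.cosh t) := by
    have := ((hasDerivAt_pow 2 (Real.cosh t)).sub_const 1).sqrt
      (by rw [← Real.sinh_sq]; positivity)
    rw [hsq] at this
    simpa using this
  have h3 : HasDerivAt (fun w => profileSlope n (Real.arcosh w))
      (profileSlopeDeriv n t * (Real.sinh t)⁻¹) (Real.cosh t) := by
    have ha := Real.hasDerivAt_arcosh hw
    rw [hsq] at ha
    refine HasDerivAt.comp (h₂ := profileSlope n) (h := Real.arcosh) (Real.cosh t) ?_ ha
    rw [Real.arcosh_cosh ht.le]
    exact hasDerivAt_profileSlope hn ht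
  have h4 := h3.mul (h2.inv (by rw [hsq]; exact hs.ne'))
  refine h4.deriv.trans ?_
  rw [Pi.inv_apply, hsq, Real.arcosh_cosh ht.le]
  field_simp
  ring

/-- The coefficient of `dr ∧ ⟨ξ, dx⟩` in the Kähler form, in terms of the profile. -/
theorem kahler_radial_coefficient_pos {n : ℕ} (hn : 2 ≤ n) {r : ℝ} (hr : 0 < r) :
    0 < potentialDeriv n (Real.cosh (2 * r)) * ((Real.sinh r / r) ^ 2 +
        (Real.cosh r - Real.sinh r / r) / r ^ 2 * Real.cosh r) +
      4 * Real.cosh r ^ 2 * (Real.sinh r / r) ^ 2 * potentialDeriv2 n (Real.cosh (2 * r)) := by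
  have ht : 0 < 2 * r := by positivity
  have h := sub_pos.2 (profileSlope_div_lt hn ht)
  rw [potentialDeriv_cosh n ht, potentialDeriv2_cosh (by omega) ht]
  have hs : 0 < Real.sinh r := Real.sinh_pos_iff.2 hr
  have hc := Real.cosh_pos r
  refine (div_pos h (by positivity : 0 < r ^ 2)).trans_eq ?_
  rw [Real.sinh_two_mul, Real.cosh_two_mul]
  field_simp
  ring

end Profile

section Kahler

/-- `sinh r / r`, with value `1` at `0`. -/
def sinhc (r : ℝ) : ℝ := dslope Real.sinh 0 r

theorem sinhc_of_ne {r : ℝ} (hr : r ≠ 0) : sinhc r = Real.sinh r / r := by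
  rw [sinhc, dslope_of_ne _ hr, slope_def_field]; simp

@[simp]
theorem sinhc_zero : sinhc 0 = 1 := by simp [sinhc]

theorem continuousAt_sinhc_zero : ContinuousAt sinhc 0 :=
  continuousAt_dslope_same.2 Real.differentiable_sinh.differentiableAt

theorem sinhc_mul_self (r : ℝ) : sinhc r * r = Real.sinh r := by
  rcases eq_or_ne r 0 with rfl | hr
  · simp
  · rw [sinhc_of_ne hr, div_mul_cancel₀ _ hr]

theorem sinhc_pos {r : ℝ} (hr : 0 ≤ r) : 0 < sinhc r := by
  rcases hr.eq_or_lt with rfl | hr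
  · simp
  · rw [sinhc_of_ne hr.ne']; exact div_pos (Real.sinh_pos_iff.2 hr) hr

/-- `(sinhc r)' / r`. -/
def sinhcDeriv (r : ℝ) : ℝ := (Real.cosh r - sinhc r) / r ^ 2

theorem sinhc_add (r : ℝ) : sinhc r + sinhcDeriv r * r ^ 2 = Real.cosh r := by
  rcases eq_or_ne r 0 with rfl | hr
  · simp
  · rw [sinhcDeriv]; field_simp; ring

theorem cosh_sq_sub_sinhc_sq (r : ℝ) : Real.cosh r ^ 2 - sinhc r ^ 2 * r ^ 2 = 1 := by
  rw [← mul_pow, sinhc_mul_self, Real.cosh_sq_sub_sinh_sq]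

variable {n : ℕ}

/-- `P + i Q`. -/
def complexVector (P Q : E (n + 1)) : Fin (n + 1) → ℂ := fun k => (P k : ℂ) + Complex.I * (Q k : ℂ)

theorem toQuadric_eq (x ξ : E (n + 1)) :
    toQuadric x ξ = complexVector (Real.cosh ‖ξ‖ • x) (sinhc ‖ξ‖ • ξ) := by
  funext k
  rcases eq_or_ne ξ 0 with rfl | hξ
  · simp [toQuadric, complexVector]
  · simp [toQuadric, complexVector, sinhc_of_ne (norm_ne_zero_iff.2 hξ)]

theorem pushforward_eq (c s s₁ : ℝ) (x η a b : E (n + 1)) :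
    pushforward c s s₁ x η a b =
      complexVector (c • a + (s * ⟪η, b⟫) • x) (s • b + (s₁ * ⟪η, b⟫) • η) := by
  funext k
  simp [pushforward, complexVector]

theorem sum_complexVector_mul_conj (P Q P' Q' : E (n + 1)) :
    ∑ k, complexVector P Q k * conj (complexVector P' Q' k) =
      ((⟪P, P'⟫ + ⟪Q, Q'⟫ : ℝ) : ℂ) + Complex.I * ((⟪Q, P'⟫ - ⟪P, Q'⟫ : ℝ) : ℂ) := by
  simp only [PiLp.inner_apply, RCLike.inner_apply, conj_trivial, complexVector]
  push_cast
  rw [← Finset.sum_add_distrib, ← Finset.sum_sub_distrib, Finset.mul_sum, ← Finset.sum_add_distrib]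
  refine Finset.sum_congr rfl fun k _ => ?_
  simp only [map_add, map_mul, Complex.conj_I, Complex.conj_ofReal]
  linear_combination (-(Q k : ℂ) * Q' k) * Complex.I_sq

theorem sqNorm_complexVector (P Q : E (n + 1)) : sqNorm (complexVector P Q) = ⟪P, P⟫ + ⟪Q, Q⟫ := by
  have h := sum_complexVector_mul_conj P Q P Q
  simp only [Complex.mul_conj] at h
  rw [sub_eq_zero.2 (real_inner_comm P Q), Complex.ofReal_zero, mul_zero, add_zero] at h
  rw [sqNorm]
  exact_mod_cast h

theorem delSqNorm_complexVector (P Q P' Q' : E (n + 1)) :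
    delSqNorm (complexVector P' Q') (complexVector P Q) =
      ((⟪P, P'⟫ + ⟪Q, Q'⟫ : ℝ) : ℂ) + Complex.I * ((⟪Q, P'⟫ - ⟪P, Q'⟫ : ℝ) : ℂ) := by
  rw [← sum_complexVector_mul_conj, delSqNorm]
  exact Finset.sum_congr rfl fun k _ => mul_comm _ _

/-- The Kähler form on vectors tangent to `T^*S^n`. -/
theorem kahlerForm_pushforward {c s s₁ : ℝ} {x η a b a' b' : E (n + 1)} (hx : ⟪x, x⟫ = 1)
    (hη : ⟪x, η⟫ = 0) (ha : ⟪x, a⟫ = 0) (ha' : ⟪x, a'⟫ = 0) (hb : ⟪x, b⟫ = -⟪η, a⟫)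
    (hb' : ⟪x, b'⟫ = -⟪η, a'⟫) (h1 : s + s₁ * ⟪η, η⟫ = c) :
    kahlerForm (complexVector (c • x) (s • η)) (pushforward c s s₁ x η a b)
        (pushforward c s s₁ x η a' b') =
      ((-(potentialDeriv n (c ^ 2 + s ^ 2 * ⟪η, η⟫) * s * c * (⟪b, a'⟫ - ⟪b', a⟫) +
        (potentialDeriv n (c ^ 2 + s ^ 2 * ⟪η, η⟫) * (s ^ 2 + s₁ * c) +
          4 * c ^ 2 * s ^ 2 * potentialDeriv2 n (c ^ 2 + s ^ 2 * ⟪η, η⟫)) *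
          (⟪η, b⟫ * ⟪η, a'⟫ - ⟪η, b'⟫ * ⟪η, a⟫)) : ℝ) : ℂ) := by
  have hn : sqNorm (complexVector (c • x) (s • η)) = c ^ 2 + s ^ 2 * ⟪η, η⟫ := by
    rw [sqNorm_complexVector]
    simp only [inner_smul_left, inner_smul_right, hx, conj_trivial]
    ring
  have hd : ∀ {a b : E (n + 1)}, ⟪x, a⟫ = 0 → ⟪x, b⟫ = -⟪η, a⟫ →
      delSqNorm (complexVector (c • x) (s • η)) (pushforward c s s₁ x η a b) =
        ((2 * c * s * ⟪η, b⟫ : ℝ) : ℂ) + Complex.I * ((-(2 * s * c * ⟪η, a⟫) : ℝ) : ℂ) := by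
    intro a b ha hb
    rw [pushforward_eq, delSqNorm_complexVector]
    simp only [inner_add_left, inner_smul_left, inner_smul_right, conj_trivial, hx, hη,
      real_inner_comm x a, ha, real_inner_comm x b, hb, real_inner_comm x η, real_inner_comm η a,
      real_inner_comm η b]
    congr 2
    · linear_combination (s * ⟪η, b⟫) * h1
    · ring_nf
  rw [kahlerForm, hn, hd ha hb, hd ha' hb', Finset.sum_sub_distrib, pushforward_eq, pushforward_eq,
    sum_complexVector_mul_conj, sum_complexVector_mul_conj]
  simp only [inner_add_left, inner_add_right, inner_smul_left, inner_smul_right, conj_trivial, hx,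
      hη, real_inner_comm x a, ha, real_inner_comm x b, hb, real_inner_comm x η, real_inner_comm η a,
      real_inner_comm η b, real_inner_comm x a', ha', real_inner_comm x b', hb',
      real_inner_comm η a', real_inner_comm η b', real_inner_comm b a', real_inner_comm b' a,
      real_inner_comm a a', real_inner_comm b b']
  simp only [map_add, map_mul, Complex.conj_I, Complex.conj_ofReal]
  push_cast
  linear_combination
    ((potentialDeriv n (c ^ 2 + s ^ 2 * ⟪η, η⟫) : ℂ) * s * c * (⟪b, a'⟫ - ⟪b', a⟫) +
        ((potentialDeriv n (c ^ 2 + s ^ 2 * ⟪η, η⟫) : ℂ) * (s ^ 2 + s₁ * c) +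
          4 * c ^ 2 * s ^ 2 * potentialDeriv2 n (c ^ 2 + s ^ 2 * ⟪η, η⟫)) *
          (⟪η, b⟫ * ⟪η, a'⟫ - ⟪η, b'⟫ * ⟪η, a⟫)) * Complex.I_sq

end Kahler

section Curves

variable {n : ℕ} {β : ℝ → E (n + 1)} {b : E (n + 1)}

theorem hasDerivAt_norm_of_ne (hβ : HasDerivAt β b 0) (h0 : β 0 ≠ 0) :
    HasDerivAt (fun t => ‖β t‖) (⟪β 0, b⟫ / ‖β 0‖) 0 := by
  have h := (hβ.norm_sq).sqrt (by simpa using h0)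
  simp only [Real.sqrt_sq (norm_nonneg _)] at h
  refine h.congr_deriv ?_
  field_simp

theorem hasDerivAt_cosh_norm (hβ : HasDerivAt β b 0) :
    HasDerivAt (fun t => Real.cosh ‖β t‖) (sinhc ‖β 0‖ * ⟪β 0, b⟫) 0 := by
  rcases eq_or_ne (β 0) 0 with h0 | h0
  · have h1 : (fun r : ℝ => Real.cosh r - 1) =o[𝓝 0] fun r => r := by
      have := (Real.hasDerivAt_cosh 0).isLittleO
      simpa using this
    have h2 : Filter.Tendsto (fun t => ‖β t‖) (𝓝 0) (𝓝 0) := by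
      have := hβ.continuousAt.norm
      rwa [ContinuousAt, h0, norm_zero] at this
    have h3 := h1.comp_tendsto h2
    have h4 : (fun t => ‖β t‖) =O[𝓝 0] fun t : ℝ => t := by
      have := hβ.isBigO_sub
      simpa [h0] using this.norm_left
    rw [hasDerivAt_iff_isLittleO]
    have := h3.trans_isBigO h4
    simpa [h0, Function.comp_def] using this
  · refine (hasDerivAt_norm_of_ne hβ h0).cosh.congr_deriv ?_
    rw [sinhc_of_ne (norm_ne_zero_iff.2 h0)]
    ring

theorem hasDerivAt_sinhc_norm_smul (hβ : HasDerivAt β b 0) :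
    HasDerivAt (fun t => sinhc ‖β t‖ • β t)
      (sinhc ‖β 0‖ • b + (sinhcDeriv ‖β 0‖ * ⟪β 0, b⟫) • β 0) 0 := by
  rcases eq_or_ne (β 0) 0 with h0 | h0
  · have h2 : Filter.Tendsto (fun t => sinhc ‖β t‖) (𝓝 0) (𝓝 1) := by
      have h := hβ.continuousAt.norm
      rw [ContinuousAt, h0, norm_zero] at h
      have := continuousAt_sinhc_zero.tendsto.comp h
      rwa [sinhc_zero] at this
    rw [hasDerivAt_iff_tendsto_slope] at hβ ⊢
    have h3 := (h2.mono_left nhdsWithin_le_nhds).smul hβ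
    simp only [h0, norm_zero, sinhc_zero, smul_zero, add_zero]
    refine h3.congr fun t => ?_
    simp only [slope, vsub_eq_sub, h0, smul_zero, sub_zero]
    rw [smul_comm]
  · have hr : ‖β 0‖ ≠ 0 := norm_ne_zero_iff.2 h0
    have hN := hasDerivAt_norm_of_ne hβ h0
    have h1 : (fun t => sinhc ‖β t‖ • β t) =ᶠ[𝓝 0] fun t => (Real.sinh ‖β t‖ / ‖β t‖) • β t := by
      filter_upwards [hβ.continuousAt.norm.eventually_ne hr] with t ht
      rw [sinhc_of_ne ht]
    refine (((hN.sinh.div hN hr).smul hβ).congr_of_eventuallyEq h1).congr_deriv ?_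
    rw [sinhcDeriv, sinhc_of_ne hr]
    congr 2
    field_simp

/-- The differential of the identification `T^*S^n ≅ Q`. -/
theorem hasDerivAt_toQuadric {y : ℝ → E (n + 1)} {a : E (n + 1)} (hy : HasDerivAt y a 0)
    (hβ : HasDerivAt β b 0) :
    HasDerivAt (fun t => toQuadric (y t) (β t))
      (pushforward (Real.cosh ‖β 0‖) (sinhc ‖β 0‖) (sinhcDeriv ‖β 0‖) (y 0) (β 0) a b) 0 := by
  simp only [toQuadric_eq]
  rw [pushforward_eq]
  have h1 := (hasDerivAt_cosh_norm hβ).smul hy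
  have h2 := hasDerivAt_sinhc_norm_smul hβ
  rw [hasDerivAt_pi]
  intro k
  have e1 := ((EuclideanSpace.proj k : E (n + 1) →L[ℝ] ℝ).hasFDerivAt.comp_hasDerivAt 0 h1).ofReal_comp
  have e2 := ((EuclideanSpace.proj k : E (n + 1) →L[ℝ] ℝ).hasFDerivAt.comp_hasDerivAt 0 h2).ofReal_comp
  exact e1.add (e2.const_mul Complex.I)

end Curves

section TangentialLift

variable {q n : ℕ}

/-- The restriction of `⟪η, ·⟫` along a linear map `D`. -/
def pairing (D : E q →L[ℝ] E (n + 1)) : E (n + 1) →L[ℝ] (E q →L[ℝ] ℝ) :=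
  ((ContinuousLinearMap.compL ℝ (E q) (E (n + 1)) ℝ).flip D).comp (innerSL ℝ)

@[simp]
theorem pairing_apply (D : E q →L[ℝ] E (n + 1)) (η : E (n + 1)) (w : E q) :
    pairing D η w = ⟪η, D w⟫ := by
  simp [pairing]

/-- The vector in the range of `D` that represents a given linear form. -/
def tangentialLift (D : E q →L[ℝ] E (n + 1)) : (E q →L[ℝ] ℝ) →L[ℝ] E (n + 1) :=
  D.comp ((pairing D).comp D).inverse

theorem isInvertible_pairing_comp {D : E q →L[ℝ] E (n + 1)} (hD : Function.Injective D) :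
    ((pairing D).comp D).IsInvertible := by
  have hinj : Function.Injective ((pairing D).comp D).toLinearMap := by
    rw [← LinearMap.ker_eq_bot, LinearMap.ker_eq_bot']
    intro w hw
    have := DFunLike.congr_fun hw w
    simp only [ContinuousLinearMap.coe_coe, ContinuousLinearMap.comp_apply, pairing_apply,
      zero_apply, inner_self_eq_zero] at this
    exact hD (this.trans (map_zero D).symm)
  have hfin : Module.finrank ℝ (E q) = Module.finrank ℝ (E q →L[ℝ] ℝ) := by
    rw [← LinearEquiv.finrank_eq (LinearMap.toContinuousLinearMap (𝕜 := ℝ) (E := E q) (F' := ℝ)),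
      Module.finrank_linearMap_self]
  exact ⟨(LinearEquiv.ofInjectiveOfFinrankEq _ hinj hfin).toContinuousLinearEquiv, by ext; rfl⟩

theorem pairing_tangentialLift {D : E q →L[ℝ] E (n + 1)} (hD : Function.Injective D)
    (l : E q →L[ℝ] ℝ) : pairing D (tangentialLift D l) = l :=
  (isInvertible_pairing_comp hD).self_apply_inverse l

theorem inner_tangentialLift {D : E q →L[ℝ] E (n + 1)} (hD : Function.Injective D)
    (l : E q →L[ℝ] ℝ) (w : E q) : ⟪tangentialLift D l, D w⟫ = l w := by
  rw [← pairing_apply, pairing_tangentialLift hD]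

theorem tangentialLift_unique {D : E q →L[ℝ] E (n + 1)} (hD : Function.Injective D)
    {l : E q →L[ℝ] ℝ} {w : E q} (h : ∀ w', ⟪D w, D w'⟫ = l w') : tangentialLift D l = D w := by
  have h1 : (pairing D).comp D w = l := by ext w'; simpa using h w'
  rw [← h1, tangentialLift, ContinuousLinearMap.comp_apply,
    (isInvertible_pairing_comp hD).inverse_apply_self]

theorem tangentialLift_comp {D : E q →L[ℝ] E (n + 1)} (hD : Function.Injective D)
    (J : E q ≃L[ℝ] E q) (l : E q →L[ℝ] ℝ) :
    tangentialLift (D.comp (J : E q →L[ℝ] E q)) (l.comp (J : E q →L[ℝ] E q)) =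
      tangentialLift D l := by
  have hDJ : Function.Injective (D.comp (J : E q →L[ℝ] E q)) := hD.comp J.injective
  have h : tangentialLift D l = (D.comp (J : E q →L[ℝ] E q))
      (J.symm (((pairing D).comp D).inverse l)) := by simp [tangentialLift]
  rw [h]
  refine tangentialLift_unique hDJ fun w' => ?_
  rw [← h]
  simp [inner_tangentialLift hD]

theorem contDiffAt_tangentialLift {D : E q →L[ℝ] E (n + 1)} (hD : Function.Injective D) :
    ContDiffAt ℝ ∞ (tangentialLift : (E q →L[ℝ] E (n + 1)) → _) D := by
  have h1 : ContDiff ℝ ∞ (pairing : (E q →L[ℝ] E (n + 1)) → _) := by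
    unfold pairing
    fun_prop
  have h2 : ContDiff ℝ ∞ (fun D : E q →L[ℝ] E (n + 1) => (pairing D).comp D) :=
    h1.clm_comp contDiff_id
  exact contDiffAt_id.clm_comp
    (ContDiffAt.comp (g := ContinuousLinearMap.inverse) (f := fun D => (pairing D).comp D) D
      (isInvertible_pairing_comp hD).contDiffAt_map_inverse h2.contDiffAt)

end TangentialLift

namespace SphereImmersion

variable {q n : ℕ} {L : Type*} [TopologicalSpace L] [ChartedSpace (E q) L]

section Pointwise

variable (x : SphereImmersion q n L) (p : L)

theorem inner_pt_self : ⟪x.pt p, x.pt p⟫ = 1 := by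
  have : ‖x.pt p‖ = 1 := by simp [pt]
  rw [real_inner_self_eq_norm_sq, this, one_pow]

theorem contMDiff_pt : ContMDiff (𝓡 q) 𝓘(ℝ, E (n + 1)) ∞ x.pt :=
  have : Fact (Module.finrank ℝ (E (n + 1)) = n + 1) := ⟨by simp⟩
  (contMDiff_coe_sphere (n := n) (m := ∞)).comp x.smooth

/-- The differential of a vector-valued function, on `ℝ^q`. -/
def coordDiff {F : Type*} [NormedAddCommGroup F] [NormedSpace ℝ F] (f : L → F) (p : L) :
    E q →L[ℝ] F := mfderiv (𝓡 q) 𝓘(ℝ, F) f p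

/-- The differential `dx_p`, on `ℝ^q`. -/
def diff : E q →L[ℝ] E (n + 1) := coordDiff x.pt p

/-- The differential of the inverse of the chart at `p`. -/
def chartDiff (p : L) (u : E q) : E q →L[ℝ] E q :=
  mfderivWithin 𝓘(ℝ, E q) (𝓡 q) (extChartAt (𝓡 q) p).symm (Set.range (𝓡 q)) u

/-- The value of a one-form, on `ℝ^q`. -/
def formAt (μ : ∀ p : L, TangentSpace (𝓡 q) p →L[ℝ] ℝ) (p : L) : E q →L[ℝ] ℝ := μ p

theorem diff_injective : Function.Injective (x.diff p) := x.dx_injective p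

theorem mem_normal {v : E (n + 1)} :
    v ∈ x.normal p ↔ ⟪x.pt p, v⟫ = 0 ∧ ∀ w : E q, ⟪x.diff p w, v⟫ = 0 := Iff.rfl

theorem inner_of_mem_normal {v : E (n + 1)} (hv : v ∈ x.normal p) (w : E q) :
    ⟪v, x.diff p w⟫ = 0 := by
  rw [real_inner_comm]; exact hv.2 w

/-- The immersion in the chart at `p`. -/
def chartMap : E q → E (n + 1) := x.pt ∘ (extChartAt (𝓡 q) p).symm

/-- The second derivative of the immersion in the chart at `p`. -/
def hessian : E q →L[ℝ] E q →L[ℝ] E (n + 1) :=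
  fderiv ℝ (fderiv ℝ (x.chartMap p)) (extChartAt (𝓡 q) p p)

end Pointwise

variable [IsManifold (𝓡 q) ∞ L] (x : SphereImmersion q n L) (p : L)

omit [IsManifold (𝓡 q) ∞ L] in
theorem chartMap_self : x.chartMap p (extChartAt (𝓡 q) p p) = x.pt p := by
  simp [chartMap]

theorem contDiffAt_comp_extChartAt_symm {F : Type*} [NormedAddCommGroup F] [NormedSpace ℝ F]
    {f : L → F} (hf : ContMDiff (𝓡 q) 𝓘(ℝ, F) ∞ f) {u : E q}
    (hu : u ∈ (extChartAt (𝓡 q) p).target) :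
    ContDiffAt ℝ ∞ (f ∘ (extChartAt (𝓡 q) p).symm) u := by
  rw [← contMDiffAt_iff_contDiffAt]
  have h1 := (contMDiffOn_extChartAt_symm (I := 𝓡 q) (n := ∞) p).contMDiffAt
    ((isOpen_extChartAt_target p).mem_nhds hu)
  exact (hf.contMDiffAt).comp u h1

theorem contDiffAt_chartMap {u : E q} (hu : u ∈ (extChartAt (𝓡 q) p).target) :
    ContDiffAt ℝ ∞ (x.chartMap p) u :=
  contDiffAt_comp_extChartAt_symm p x.contMDiff_pt hu

theorem contDiffAt_fderiv_chartMap {u : E q} (hu : u ∈ (extChartAt (𝓡 q) p).target) :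
    ContDiffAt ℝ ∞ (fderiv ℝ (x.chartMap p)) u :=
  (x.contDiffAt_chartMap p hu).fderiv_right (by simp)

omit [IsManifold (𝓡 q) ∞ L] in
theorem hasFDerivAt_comp_extChartAt_symm {F : Type*} [NormedAddCommGroup F] [NormedSpace ℝ F]
    {f : L → F} (hf : ContMDiff (𝓡 q) 𝓘(ℝ, F) ∞ f) :
    HasFDerivAt (f ∘ (extChartAt (𝓡 q) p).symm) (coordDiff f p)
      (extChartAt (𝓡 q) p p) := by
  have h := (hf.mdifferentiable (by simp) p).hasMFDerivAt.2
  simp only [writtenInExtChartAt, extChartAt_model_space_eq_id, PartialEquiv.refl_coe,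
    Function.id_comp, ModelWithCorners.range_eq_univ] at h
  have h' : HasFDerivWithinAt (f ∘ (extChartAt (𝓡 q) p).symm) (coordDiff f p) Set.univ
    (extChartAt (𝓡 q) p p) := h
  exact hasFDerivWithinAt_univ.1 h'

omit [IsManifold (𝓡 q) ∞ L] in
theorem fderiv_chartMap_self : fderiv ℝ (x.chartMap p) (extChartAt (𝓡 q) p p) = x.diff p :=
  (hasFDerivAt_comp_extChartAt_symm p x.contMDiff_pt).fderiv

theorem hessian_symm (w w' : E q) : x.hessian p w w' = x.hessian p w' w :=
  ((x.contDiffAt_chartMap p (mem_extChartAt_target p)).isSymmSndFDerivAt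
    (by rw [minSmoothness_of_isRCLikeNormedField]; exact WithTop.coe_le_coe.2 (le_top : (2 : ℕ∞) ≤ ⊤))).eq w w'

/-- The differential of the inverse chart. -/
theorem exists_chart_diff {u : E q} (hu : u ∈ (extChartAt (𝓡 q) p).target) :
    ∃ J : E q ≃L[ℝ] E q, chartDiff p u = (J : E q →L[ℝ] E q) ∧
      fderiv ℝ (x.chartMap p) u =
        (x.diff ((extChartAt (𝓡 q) p).symm u)).comp (J : E q →L[ℝ] E q) := by
  have : IsManifold (𝓡 q) 1 L := IsManifold.of_le (n := ∞) (by simp)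
  obtain ⟨J, hJ⟩ : (chartDiff p u).IsInvertible :=
    isInvertible_mfderivWithin_extChartAt_symm (I := 𝓡 q) hu
  refine ⟨J, hJ.symm, ?_⟩
  have h1 := (mdifferentiableWithinAt_extChartAt_symm (I := 𝓡 q) hu).hasMFDerivWithinAt
  change HasMFDerivWithinAt _ _ _ _ _ (chartDiff p u) at h1
  rw [← hJ] at h1
  have h2 := (x.contMDiff_pt.mdifferentiable (by simp)
    ((extChartAt (𝓡 q) p).symm u)).hasMFDerivAt
  have h3 := h2.comp_hasMFDerivWithinAt u h1
  rw [ModelWithCorners.range_eq_univ, hasMFDerivWithinAt_univ] at h3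
  have h4 : HasFDerivAt (x.chartMap p)
      ((x.diff ((extChartAt (𝓡 q) p).symm u)).comp (J : E q →L[ℝ] E q)) u := h3.hasFDerivAt
  exact h4.fderiv

omit [IsManifold (𝓡 q) ∞ L] in
theorem inner_pt_diff (w : E q) : ⟪x.pt p, x.diff p w⟫ = 0 := by
  have h := hasFDerivAt_comp_extChartAt_symm p x.contMDiff_pt
  have h1 := (h.inner ℝ h)
  have h2 : (fun u => ⟪(x.pt ∘ (extChartAt (𝓡 q) p).symm) u,
      (x.pt ∘ (extChartAt (𝓡 q) p).symm) u⟫) = fun _ => (1 : ℝ) := by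
    funext u; exact x.inner_pt_self _
  rw [h2] at h1
  have h3 := DFunLike.congr_fun (h1.unique (hasFDerivAt_const 1 _)) w
  simp only [Function.comp, extChartAt_to_inv, fderivInnerCLM_apply,
    ContinuousLinearMap.comp_apply, ContinuousLinearMap.prod_apply,
    zero_apply] at h3
  change ⟪x.pt p, x.diff p w⟫ + ⟪x.diff p w, x.pt p⟫ = 0 at h3
  rw [real_inner_comm (x.pt p)] at h3
  linarith

theorem mem_normal_chart {u : E q} (hu : u ∈ (extChartAt (𝓡 q) p).target) {v : E (n + 1)} :
    v ∈ x.normal ((extChartAt (𝓡 q) p).symm u) ↔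
      ⟪x.chartMap p u, v⟫ = 0 ∧ ∀ w, ⟪fderiv ℝ (x.chartMap p) u w, v⟫ = 0 := by
  obtain ⟨J, -, hJ⟩ := x.exists_chart_diff p hu
  rw [mem_normal, hJ]
  refine and_congr Iff.rfl ⟨fun h w => h _, fun h w => ?_⟩
  simpa using h (J.symm w)

/-! ### Normal projection and the dual of a one-form -/

/-- The projection of a constant vector to the normal bundle. -/
def normalProj (ξ : E (n + 1)) (p : L) : E (n + 1) :=
  ξ - ⟪x.pt p, ξ⟫ • x.pt p - tangentialLift (x.diff p) (pairing (x.diff p) ξ)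

omit [IsManifold (𝓡 q) ∞ L] in
theorem inner_pt_tangentialLift (l : E q →L[ℝ] ℝ) :
    ⟪x.pt p, tangentialLift (x.diff p) l⟫ = 0 :=
  x.inner_pt_diff p _

omit [IsManifold (𝓡 q) ∞ L] in
theorem normalProj_mem (ξ : E (n + 1)) : x.normalProj ξ p ∈ x.normal p := by
  rw [mem_normal]
  refine ⟨?_, fun w => ?_⟩
  · simp [normalProj, inner_sub_right, inner_smul_right, inner_pt_self, inner_pt_tangentialLift,
      -inner_self_eq_norm_sq_to_K]
  · rw [real_inner_comm, normalProj, inner_sub_left, inner_sub_left,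
      inner_tangentialLift (x.diff_injective p), pairing_apply, inner_smul_left, inner_pt_diff]
    simp

omit [IsManifold (𝓡 q) ∞ L] in
theorem normalProj_of_mem {ξ : E (n + 1)} (hξ : ξ ∈ x.normal p) : x.normalProj ξ p = ξ := by
  have h : pairing (x.diff p) ξ = 0 := by
    ext w; simpa using x.inner_of_mem_normal p hξ w
  rw [normalProj, h, hξ.1]
  simp

theorem normalProj_chart (ξ : E (n + 1)) {u : E q} (hu : u ∈ (extChartAt (𝓡 q) p).target) :
    x.normalProj ξ ((extChartAt (𝓡 q) p).symm u) =
      ξ - ⟪x.chartMap p u, ξ⟫ • x.chartMap p u -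
        tangentialLift (fderiv ℝ (x.chartMap p) u) (pairing (fderiv ℝ (x.chartMap p) u) ξ) := by
  obtain ⟨J, -, hJ⟩ := x.exists_chart_diff p hu
  rw [normalProj, hJ, ← tangentialLift_comp (x.diff_injective _) J]
  rfl

theorem fderiv_chartMap_injective {u : E q} (hu : u ∈ (extChartAt (𝓡 q) p).target) :
    Function.Injective (fderiv ℝ (x.chartMap p) u) := by
  obtain ⟨J, -, hJ⟩ := x.exists_chart_diff p hu
  rw [hJ]
  exact (x.diff_injective _).comp J.injective

omit [IsManifold (𝓡 q) ∞ L] in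
theorem contMDiffAt_of_chart {F : Type*} [NormedAddCommGroup F] [NormedSpace ℝ F]
    {f : L → F} {g : E q → F} (hfg : ∀ u ∈ (extChartAt (𝓡 q) p).target,
      f ((extChartAt (𝓡 q) p).symm u) = g u) (hg : ContDiffAt ℝ ∞ g (extChartAt (𝓡 q) p p)) :
    ContMDiffAt (𝓡 q) 𝓘(ℝ, F) ∞ f p := by
  have h1 : ContMDiffAt (𝓡 q) 𝓘(ℝ, F) ∞ (g ∘ extChartAt (𝓡 q) p) p :=
    hg.contMDiffAt.comp p contMDiffAt_extChartAt
  refine h1.congr_of_eventuallyEq ?_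
  filter_upwards [extChartAt_source_mem_nhds (I := 𝓡 q) p] with p' hp'
  rw [Function.comp, ← hfg _ ((extChartAt (𝓡 q) p).map_source hp'),
    (extChartAt (𝓡 q) p).left_inv hp']

theorem contMDiff_normalProj (ξ : E (n + 1)) :
    ContMDiff (𝓡 q) 𝓘(ℝ, E (n + 1)) ∞ (x.normalProj ξ) := by
  intro p
  refine contMDiffAt_of_chart p (fun u hu => x.normalProj_chart p ξ hu) ?_
  have hp := mem_extChartAt_target (I := 𝓡 q) p
  have h1 := x.contDiffAt_chartMap p hp
  have h2 := x.contDiffAt_fderiv_chartMap p hp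
  have h3 : ContDiff ℝ ∞ fun D : E q →L[ℝ] E (n + 1) => pairing D ξ := by
    unfold pairing
    fun_prop
  refine ContDiffAt.sub (contDiffAt_const.sub ((h1.inner ℝ contDiffAt_const).smul h1)) ?_
  exact ((contDiffAt_tangentialLift (x.fderiv_chartMap_injective p hp)).comp _ h2).clm_apply
    (h3.contDiffAt.comp _ h2)

theorem isNormalField_normalProj (ξ : E (n + 1)) : x.IsNormalField (x.normalProj ξ) :=
  ⟨x.contMDiff_normalProj ξ, fun p => x.normalProj_mem p ξ⟩

/-- The vector field along `x` dual to the one-form `μ`. -/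
def sharp (μ : ∀ p : L, TangentSpace (𝓡 q) p →L[ℝ] ℝ) (p : L) : E (n + 1) :=
  tangentialLift (x.diff p) (formAt μ p)

theorem contMDiff_sharp {μ : ∀ p : L, TangentSpace (𝓡 q) p →L[ℝ] ℝ} (hμ : IsSmoothOneForm μ) :
    ContMDiff (𝓡 q) 𝓘(ℝ, E (n + 1)) ∞ (x.sharp μ) := by
  have : IsManifold (𝓡 q) 1 L := IsManifold.of_le (n := ∞) (by simp)
  intro p
  let l : E q → (E q →L[ℝ] ℝ) := fun u => (formAt μ ((extChartAt (𝓡 q) p).symm u)).comp (chartDiff p u)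
  have hp := mem_extChartAt_target (I := 𝓡 q) p
  have h2 := x.contDiffAt_fderiv_chartMap p hp
  have hl : ContDiffAt ℝ ∞ l (extChartAt (𝓡 q) p p) := by
    have h := ((contMDiffAt_hom_bundle _).1 (hμ p)).2
    have h4 := (contMDiffOn_extChartAt_symm (I := 𝓡 q) (n := ∞) p).contMDiffAt
      ((isOpen_extChartAt_target p).mem_nhds hp)
    have h5 : ContDiffAt ℝ ∞ _ (extChartAt (𝓡 q) p p) :=
      contMDiffAt_iff_contDiffAt.1 (ContMDiffAt.comp (extChartAt (𝓡 q) p p)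
        (by simpa only [extChartAt_to_inv] using h) h4)
    refine h5.congr_of_eventuallyEq ?_
    filter_upwards [(isOpen_extChartAt_target (I := 𝓡 q) p).mem_nhds hp] with u hu
    have hs : (extChartAt (𝓡 q) p).symm u ∈ (chartAt (E q) p).source := by
      simpa using (extChartAt (𝓡 q) p).map_target hu
    simp only [Function.comp, ContinuousLinearMap.inCoordinates]
    rw [TangentBundle.symmL_trivializationAt hs, (extChartAt (𝓡 q) p).right_inv hu]
    ext w
    simp [l, formAt, chartDiff]
    rfl
  refine contMDiffAt_of_chart p (g := fun u => tangentialLift (fderiv ℝ (x.chartMap p) u) (l u))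
    (fun u hu => ?_) ?_
  · obtain ⟨J, hJ', hJ⟩ := x.exists_chart_diff p hu
    rw [hJ, sharp, ← tangentialLift_comp (x.diff_injective _) J]
    rw [← hJ']
  · exact ((contDiffAt_tangentialLift (x.fderiv_chartMap_injective p hp)).comp _ h2).clm_apply hl

end SphereImmersion

namespace SphereImmersion

variable {q n : ℕ} {L : Type*} [TopologicalSpace L] [ChartedSpace (E q) L]
  [IsManifold (𝓡 q) ∞ L] (x : SphereImmersion q n L) (p : L)

section ChartCurves

variable {p} {c : ℝ → E q} {w : E q} {β : ℝ → E (n + 1)} {b : E (n + 1)}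

theorem hasDerivAt_chartMap (hc : HasDerivAt c w 0) (h0 : c 0 = extChartAt (𝓡 q) p p) :
    HasDerivAt (fun t => x.chartMap p (c t)) (x.diff p w) 0 := by
  have h := ((x.contDiffAt_chartMap p (mem_extChartAt_target p)).differentiableAt
    (by simp)).hasFDerivAt
  rw [← h0] at h
  have := h.comp_hasDerivAt 0 hc
  rwa [h0, fderiv_chartMap_self] at this

theorem hasDerivAt_fderiv_chartMap (hc : HasDerivAt c w 0) (h0 : c 0 = extChartAt (𝓡 q) p p)
    (w' : E q) :
    HasDerivAt (fun t => fderiv ℝ (x.chartMap p) (c t) w') (x.hessian p w w') 0 := by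
  have h := ((x.contDiffAt_fderiv_chartMap p (mem_extChartAt_target p)).differentiableAt
    (by simp)).hasFDerivAt
  rw [← h0] at h
  have h2 := (h.comp_hasDerivAt 0 hc).clm_apply (hasDerivAt_const 0 w')
  simpa [h0, hessian] using h2

theorem inner_add_eq_zero {f g : ℝ → E (n + 1)} {a b : E (n + 1)} (hf : HasDerivAt f a 0)
    (hg : HasDerivAt g b 0) (h : ∀ᶠ t in 𝓝 0, ⟪f t, g t⟫ = 0) : ⟪f 0, b⟫ + ⟪a, g 0⟫ = 0 := by
  have h1 := hf.inner ℝ hg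
  have h2 : (fun t => ⟪f t, g t⟫) =ᶠ[𝓝 0] fun _ => (0 : ℝ) := h
  exact h1.unique ((hasDerivAt_const (0 : ℝ) (0 : ℝ)).congr_of_eventuallyEq h2)

theorem inner_pt_of_curve (hc : HasDerivAt c w 0) (h0 : c 0 = extChartAt (𝓡 q) p p)
    (hβ : HasDerivAt β b 0) (h : ∀ᶠ t in 𝓝 0, ⟪x.chartMap p (c t), β t⟫ = 0) :
    ⟪x.pt p, b⟫ = -⟪β 0, x.diff p w⟫ := by
  have := inner_add_eq_zero (x.hasDerivAt_chartMap hc h0) hβ h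
  rw [h0, chartMap_self, real_inner_comm (β 0)] at this
  linarith

theorem inner_diff_of_curve (hc : HasDerivAt c w 0) (h0 : c 0 = extChartAt (𝓡 q) p p)
    (hβ : HasDerivAt β b 0) {w' : E q}
    (h : ∀ᶠ t in 𝓝 0, ⟪fderiv ℝ (x.chartMap p) (c t) w', β t⟫ = 0) :
    ⟪x.diff p w', b⟫ = -⟪x.hessian p w w', β 0⟫ := by
  have := inner_add_eq_zero (x.hasDerivAt_fderiv_chartMap hc h0 w') hβ h
  rw [h0, fderiv_chartMap_self] at this
  linarith

/-- The first order condition on the velocity `(dx w, b)` of a curve in the conormal bundle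
through `(p, ξ)`. -/
def IsConormalVelocity (ξ : E (n + 1)) (w : E q) (b : E (n + 1)) : Prop :=
  ⟪x.pt p, b⟫ = 0 ∧ ∀ w', ⟪x.diff p w', b⟫ = -⟪x.hessian p w w', ξ⟫

theorem isConormalVelocity_of_curve (hc : HasDerivAt c w 0) (h0 : c 0 = extChartAt (𝓡 q) p p)
    (hβ : HasDerivAt β b 0)
    (h : ∀ᶠ t in 𝓝 0, β t ∈ x.normal ((extChartAt (𝓡 q) p).symm (c t))) :
    x.IsConormalVelocity (p := p) (β 0) w b := by
  have hT : ∀ᶠ t in 𝓝 0, c t ∈ (extChartAt (𝓡 q) p).target :=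
    hc.continuousAt.eventually_mem (by rw [h0]; exact extChartAt_target_mem_nhds p)
  have h' : ∀ᶠ t in 𝓝 0, ⟪x.chartMap p (c t), β t⟫ = 0 ∧
      ∀ w, ⟪fderiv ℝ (x.chartMap p) (c t) w, β t⟫ = 0 := by
    filter_upwards [h, hT] with t ht htT
    exact (x.mem_normal_chart p htT).1 ht
  have hβ0 : β 0 ∈ x.normal p := by simpa [h0] using h.self_of_nhds
  refine ⟨?_, fun w' => x.inner_diff_of_curve hc h0 hβ (h'.mono fun t ht => ht.2 w')⟩
  rw [x.inner_pt_of_curve hc h0 hβ (h'.mono fun t ht => ht.1), x.inner_of_mem_normal p hβ0,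
    neg_zero]

end ChartCurves

/-! ### The twisted conormal bundle and its tangent vectors -/

/-- The inclusion of a tangent vector `(a, b)` of `T^*S^n` at `(x, η)` into `T Q`. -/
def embed (η a b : E (n + 1)) : Fin (n + 1) → ℂ :=
  pushforward (Real.cosh ‖η‖) (sinhc ‖η‖) (sinhcDeriv ‖η‖) (x.pt p) η a b

variable {μ : ∀ p : L, TangentSpace (𝓡 q) p →L[ℝ] ℝ}

omit [IsManifold (𝓡 q) ∞ L] in
theorem add_sharp_mem_twistedFibre {ξ : E (n + 1)} (hξ : ξ ∈ x.normal p) :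
    ξ + x.sharp μ p ∈ x.twistedFibre μ p :=
  ⟨ξ, hξ, x.sharp μ p, ⟨_, rfl⟩, fun w => inner_tangentialLift (x.diff_injective p) _ w, rfl⟩

omit [IsManifold (𝓡 q) ∞ L] in
theorem mem_normal_of_mem_twistedFibre (hμ : ∀ p, μ p = 0) {η : E (n + 1)}
    (hη : η ∈ x.twistedFibre μ p) : η ∈ x.normal p := by
  obtain ⟨ξ, hξ, m, ⟨w, rfl⟩, hm, rfl⟩ := hη
  have : ⟪x.dx p w, x.dx p w⟫ = 0 := by
    have := hm w
    rwa [hμ p] at this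
  have h0 : (x.dx p).toLinearMap w = 0 := inner_self_eq_zero.1 this
  rw [h0, add_zero]
  exact hξ

omit [IsManifold (𝓡 q) ∞ L] in
theorem mem_twistedFibre_of_mem_normal (hμ : ∀ p, μ p = 0) {η : E (n + 1)}
    (hη : η ∈ x.normal p) : η ∈ x.twistedFibre μ p :=
  ⟨η, hη, 0, zero_mem _, fun w => by rw [hμ p]; exact inner_zero_left _, by rw [add_zero]⟩

omit [IsManifold (𝓡 q) ∞ L] in
theorem inner_pt_of_mem_twistedFibre {η : E (n + 1)} (hη : η ∈ x.twistedFibre μ p) :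
    ⟪x.pt p, η⟫ = 0 := by
  obtain ⟨ξ, hξ, m, ⟨w, rfl⟩, hm, rfl⟩ := hη
  rw [inner_add_right, hξ.1, zero_add]
  exact x.inner_pt_diff p w

omit [IsManifold (𝓡 q) ∞ L] in
theorem inner_diff_of_mem_twistedFibre {η : E (n + 1)} (hη : η ∈ x.twistedFibre μ p) (w : E q) :
    ⟪η, x.diff p w⟫ = formAt μ p w := by
  obtain ⟨ξ, hξ, m, hm', hm, rfl⟩ := hη
  rw [inner_add_left, x.inner_of_mem_normal p hξ, zero_add]
  exact hm w

omit [IsManifold (𝓡 q) ∞ L] in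
theorem hasDerivAt_embed {γ : ℝ → L} {β : ℝ → E (n + 1)} {a b : E (n + 1)} (h0 : γ 0 = p)
    (hγ : HasDerivAt (fun t => x.pt (γ t)) a 0) (hβ : HasDerivAt β b 0) :
    HasDerivAt (fun t => toQuadric (x.pt (γ t)) (β t)) (x.embed p (β 0) a b) 0 := by
  have := hasDerivAt_toQuadric hγ hβ
  rwa [h0] at this

theorem IsTangentVector.exists_embed {η : E (n + 1)} {V : Fin (n + 1) → ℂ}
    (hV : x.IsTangentVector μ p η V) :
    ∃ w b, V = x.embed p η (x.diff p w) b ∧ ⟪x.pt p, b⟫ = -⟪η, x.diff p w⟫ ∧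
      ((∀ p, μ p = 0) → x.IsConormalVelocity (p := p) η w b) := by
  obtain ⟨γ, β, hγ0, rfl, hγ, hβ, hfib, hV⟩ := hV
  subst hγ0
  let c : ℝ → E q := fun t => extChartAt (𝓡 q) (γ 0) (γ t)
  have hc : HasDerivAt c (deriv c 0) 0 := by
    have h1 : ContMDiffAt 𝓘(ℝ, ℝ) 𝓘(ℝ, E q) ∞ c 0 :=
      ContMDiffAt.comp (0 : ℝ) (contMDiffAt_extChartAt (x := γ 0)) hγ
    exact (h1.contDiffAt.differentiableAt (by simp)).hasDerivAt
  have hβ' := (hβ.differentiableAt (by simp)).hasDerivAt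
  have hsrc : ∀ᶠ t in 𝓝 (0 : ℝ), γ t ∈ (extChartAt (𝓡 q) (γ 0)).source :=
    hγ.continuousAt.eventually_mem (extChartAt_source_mem_nhds (γ 0))
  have hsymm : ∀ᶠ t in 𝓝 (0 : ℝ), (extChartAt (𝓡 q) (γ 0)).symm (c t) = γ t :=
    hsrc.mono fun t ht => (extChartAt (𝓡 q) (γ 0)).left_inv ht
  have hpt : HasDerivAt (fun t => x.pt (γ t)) (x.diff (γ 0) (deriv c 0)) 0 := by
    refine (x.hasDerivAt_chartMap hc rfl).congr_of_eventuallyEq ?_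
    filter_upwards [hsymm] with t ht
    rw [chartMap, Function.comp, ht]
  refine ⟨deriv c 0, deriv β 0, hV.unique (x.hasDerivAt_embed _ rfl hpt hβ'), ?_, fun hμ => ?_⟩
  · refine x.inner_pt_of_curve hc rfl hβ' ?_
    filter_upwards [hsymm, hfib] with t ht ht'
    rw [chartMap, Function.comp, ht]
    exact x.inner_pt_of_mem_twistedFibre _ ht'
  · refine x.isConormalVelocity_of_curve hc rfl hβ' ?_
    filter_upwards [hsymm, hfib] with t ht ht'
    rw [ht]
    exact x.mem_normal_of_mem_twistedFibre _ hμ ht'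

omit [IsManifold (𝓡 q) ∞ L] in
theorem isTangentVector_vertical {η ν : E (n + 1)} (hη : η ∈ x.twistedFibre μ p)
    (hν : ν ∈ x.normal p) : x.IsTangentVector μ p η (x.embed p η 0 ν) := by
  have hβ : HasDerivAt (fun t : ℝ => η + t • ν) ν 0 := by
    simpa using ((hasDerivAt_id (0 : ℝ)).smul_const ν).const_add η
  refine ⟨fun _ => p, fun t => η + t • ν, rfl, by simp, contMDiffAt_const, by fun_prop,
    Filter.Eventually.of_forall fun t => ?_, ?_⟩
  · obtain ⟨ξ, hξ, m, hm', hm, rfl⟩ := hη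
    exact ⟨ξ + t • ν, add_mem hξ (Submodule.smul_mem _ _ hν), m, hm', hm, add_right_comm _ _ _⟩
  · have := x.hasDerivAt_embed p (γ := fun _ => p) rfl (hasDerivAt_const _ _) hβ
    simpa using this

omit [IsManifold (𝓡 q) ∞ L] in
theorem normalProj_add_smul (ξ ν : E (n + 1)) (t : ℝ) :
    x.normalProj (ξ + t • ν) p = x.normalProj ξ p + t • x.normalProj ν p := by
  simp only [normalProj, inner_add_right, inner_smul_right, map_add, map_smul, smul_sub, add_smul,
    smul_smul]
  abel

theorem exists_isTangentVector (hμ : IsSmoothOneForm μ) {ξ : E (n + 1)} (hξ : ξ ∈ x.normal p)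
    (w : E q) : ∃ b, ⟪x.pt p, b⟫ = -⟪ξ + x.sharp μ p, x.diff p w⟫ ∧
      ((∀ p, μ p = 0) → x.IsConormalVelocity (p := p) (ξ + x.sharp μ p) w b) ∧ ∀ ν ∈ x.normal p, x.IsTangentVector μ p (ξ + x.sharp μ p)
      (x.embed p (ξ + x.sharp μ p) (x.diff p w) (b + ν)) := by
  set u₀ := extChartAt (𝓡 q) p p with hu₀
  let c : ℝ → E q := fun t => u₀ + t • w
  have hc : HasDerivAt (fun t : ℝ => u₀ + t • w) w 0 := by
    simpa using ((hasDerivAt_id (0 : ℝ)).smul_const w).const_add u₀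
  change HasDerivAt c w 0 at hc
  have hc0 : c 0 = u₀ := by simp [c]
  have hp := mem_extChartAt_target (I := 𝓡 q) p
  have hcs : ContDiffAt ℝ ∞ c 0 := by unfold c; fun_prop
  let γ : ℝ → L := fun t => (extChartAt (𝓡 q) p).symm (c t)
  have hγ0 : γ 0 = p := by simp [γ, hc0, hu₀]
  have hsm : ∀ {f : L → E (n + 1)}, ContMDiff (𝓡 q) 𝓘(ℝ, E (n + 1)) ∞ f →
      ContDiffAt ℝ ∞ (fun t => f (γ t)) 0 := fun {f} hf => by
    have h := contDiffAt_comp_extChartAt_symm p hf hp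
    rw [← hu₀, ← hc0] at h
    exact h.comp 0 hcs
  have hγ : ContMDiffAt 𝓘(ℝ, ℝ) (𝓡 q) ∞ γ 0 := by
    have h4 := (contMDiffOn_extChartAt_symm (I := 𝓡 q) (n := ∞) p).contMDiffAt
      ((isOpen_extChartAt_target p).mem_nhds hp)
    rw [← hu₀, ← hc0] at h4
    exact ContMDiffAt.comp (0 : ℝ) h4 hcs.contMDiffAt
  have hpt : HasDerivAt (fun t => x.pt (γ t)) (x.diff p w) 0 := x.hasDerivAt_chartMap hc hc0
  have h1 := hsm (x.contMDiff_normalProj ξ)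
  have h2 := hsm (x.contMDiff_sharp hμ)
  have hb := (h1.differentiableAt (by simp)).hasDerivAt.add (h2.differentiableAt (by simp)).hasDerivAt
  have hfib : ∀ t, x.normalProj ξ (γ t) + x.sharp μ (γ t) ∈ x.twistedFibre μ (γ t) :=
    fun t => x.add_sharp_mem_twistedFibre _ (x.normalProj_mem _ _)
  have hb0 : x.normalProj ξ (γ 0) + x.sharp μ (γ 0) = ξ + x.sharp μ p := by
    rw [hγ0, x.normalProj_of_mem p hξ]
  refine ⟨deriv (fun t => x.normalProj ξ (γ t)) 0 + deriv (fun t => x.sharp μ (γ t)) 0,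
    ?_, fun hμ0 => ?_, fun ν hν => ?_⟩
  · rw [← hb0]
    exact x.inner_pt_of_curve hc hc0 hb
      (Filter.Eventually.of_forall fun t => x.inner_pt_of_mem_twistedFibre _ (hfib t))
  · rw [← hb0]
    exact x.isConormalVelocity_of_curve hc hc0 hb
      (Filter.Eventually.of_forall fun t => x.mem_normal_of_mem_twistedFibre _ hμ0 (hfib t))
  have h3 := hsm (x.contMDiff_normalProj ν)
  have hd : HasDerivAt (fun t => x.normalProj (ξ + t • ν) (γ t) + x.sharp μ (γ t))
      (deriv (fun t => x.normalProj ξ (γ t)) 0 + deriv (fun t => x.sharp μ (γ t)) 0 + ν) 0 := by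
    simp only [normalProj_add_smul]
    have e3 := (hasDerivAt_id (0 : ℝ)).smul (h3.differentiableAt (by simp)).hasDerivAt
    refine (((h1.differentiableAt (by simp)).hasDerivAt.add e3).add
      (h2.differentiableAt (by simp)).hasDerivAt).congr_deriv ?_
    simp only [id, zero_smul, one_smul, zero_add, hγ0, x.normalProj_of_mem p hν]
    abel
  have hβ0 : x.normalProj (ξ + (0 : ℝ) • ν) (γ 0) + x.sharp μ (γ 0) = ξ + x.sharp μ p := by
    rw [zero_smul, add_zero, hγ0, x.normalProj_of_mem p hξ]
  refine ⟨γ, fun t => x.normalProj (ξ + t • ν) (γ t) + x.sharp μ (γ t), hγ0, hβ0, hγ, ?_,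
    Filter.Eventually.of_forall fun t => ?_, ?_⟩
  · simp only [normalProj_add_smul]
    exact (h1.add (contDiffAt_id.smul h3)).add h2
  · exact x.add_sharp_mem_twistedFibre _ (x.normalProj_mem _ _)
  · have := x.hasDerivAt_embed p hγ0 hpt hd
    rwa [hβ0] at this

theorem isTangentVector_of_isConormalVelocity (hμ : IsSmoothOneForm μ) (hμ0 : ∀ p, μ p = 0)
    {ξ : E (n + 1)} (hξ : ξ ∈ x.normal p) {w : E q} {b : E (n + 1)}
    (hb : x.IsConormalVelocity (p := p) ξ w b) :
    x.IsTangentVector μ p ξ (x.embed p ξ (x.diff p w) b) := by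
  have h0 : x.sharp μ p = 0 := by
    have : formAt μ p = 0 := hμ0 p
    rw [sharp, this, map_zero]
  obtain ⟨b₀, -, hb₀, h⟩ := x.exists_isTangentVector p hμ hξ w
  rw [h0, add_zero] at hb₀ h
  have hν : b - b₀ ∈ x.normal p := by
    rw [mem_normal, inner_sub_right, hb.1, (hb₀ hμ0).1, sub_zero]
    refine ⟨rfl, fun w' => ?_⟩
    rw [inner_sub_right, hb.2, (hb₀ hμ0).2, sub_self]
  simpa using h _ hν

/-! ### The shape operator -/

omit [IsManifold (𝓡 q) ∞ L] in
theorem diff_shapeOperator (ν : L → E (n + 1)) (w w' : E q) :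
    ⟪x.diff p w', x.diff p (x.shapeOperator ν p w)⟫ = ⟪x.diff p w', coordDiff ν p w⟫ := by
  have h : x.diff p (x.shapeOperator ν p w) =
      (x.tangent p).orthogonalProjectionOnto (coordDiff ν p w) := by
    exact congrArg Subtype.val ((LinearEquiv.ofInjective (x.dx p).toLinearMap
      (x.dx_injective p)).apply_symm_apply _)
  rw [h]
  exact (x.tangent p).inner_orthogonalProjectionOnto_eq_of_mem_left ⟨x.diff p w', ⟨w', rfl⟩⟩ _

theorem inner_diff_shapeOperator {ν : L → E (n + 1)} (hν : x.IsNormalField ν) (w w' : E q) :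
    ⟪x.diff p w', x.diff p (x.shapeOperator ν p w)⟫ = -⟪x.hessian p w w', ν p⟫ := by
  rw [diff_shapeOperator]
  have hc : HasDerivAt (fun t : ℝ => extChartAt (𝓡 q) p p + t • w) w 0 := by
    simpa using ((hasDerivAt_id (0 : ℝ)).smul_const w).const_add (extChartAt (𝓡 q) p p)
  have h0 : extChartAt (𝓡 q) p p + (0 : ℝ) • w = extChartAt (𝓡 q) p p := by simp
  have h := hasFDerivAt_comp_extChartAt_symm p hν.smooth
  rw [← h0] at h
  have hβ := h.comp_hasDerivAt 0 hc
  have := (x.isConormalVelocity_of_curve hc h0 hβ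
    (Filter.Eventually.of_forall fun t => hν.normal _)).2 w'
  simpa using this

theorem splits_charpoly_shapeOperator {ν : L → E (n + 1)} (hν : x.IsNormalField ν) :
    (x.shapeOperator ν p).charpoly.Splits := by
  let e := LinearEquiv.ofInjective (x.diff p).toLinearMap (x.diff_injective p)
  rw [← LinearEquiv.charpoly_conj e]
  apply LinearMap.IsSymmetric.splits_charpoly
  intro u v
  obtain ⟨u, rfl⟩ := e.surjective u
  obtain ⟨v, rfl⟩ := e.surjective v
  rw [LinearEquiv.conj_apply_apply, LinearEquiv.conj_apply_apply, e.symm_apply_apply,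
    e.symm_apply_apply]
  change ⟪x.diff p (x.shapeOperator ν p u), x.diff p v⟫ =
    ⟪x.diff p u, x.diff p (x.shapeOperator ν p v)⟫
  rw [real_inner_comm, inner_diff_shapeOperator x p hν, inner_diff_shapeOperator x p hν,
    hessian_symm]

end SphereImmersion

namespace SphereImmersion

variable {q n : ℕ} {L : Type*} [TopologicalSpace L] [ChartedSpace (E q) L]
  [IsManifold (𝓡 q) ∞ L] (x : SphereImmersion q n L) {p : L}
  {μ : ∀ p : L, TangentSpace (𝓡 q) p →L[ℝ] ℝ}

omit [IsManifold (𝓡 q) ∞ L] in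
theorem normal_spec (p : L) (v : E (n + 1)) :
    v ∈ x.normal p ↔ ⟪x.pt p, v⟫ = 0 ∧ ∀ w, ⟪(x.diff p).toLinearMap w, v⟫ = 0 := Iff.rfl

theorem sinhc_add_mul_inner (η : E (n + 1)) :
    sinhc ‖η‖ + sinhcDeriv ‖η‖ * ⟪η, η⟫ = Real.cosh ‖η‖ := by
  rw [real_inner_self_eq_norm_sq, sinhc_add]

theorem cosh_sq_sub_mul_inner (η : E (n + 1)) :
    Real.cosh ‖η‖ ^ 2 - sinhc ‖η‖ ^ 2 * ⟪η, η⟫ = 1 := by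
  rw [real_inner_self_eq_norm_sq, cosh_sq_sub_sinhc_sq]

omit [IsManifold (𝓡 q) ∞ L] in
theorem kahlerForm_embed {η b b' : E (n + 1)} {w w' : E q} (hη : ⟪x.pt p, η⟫ = 0)
    (hb : ⟪x.pt p, b⟫ = -⟪η, x.diff p w⟫) (hb' : ⟪x.pt p, b'⟫ = -⟪η, x.diff p w'⟫) :
    kahlerForm (toQuadric (x.pt p) η) (x.embed p η (x.diff p w) b)
        (x.embed p η (x.diff p w') b') =
      ((-(potentialDeriv n (Real.cosh (2 * ‖η‖)) * sinhc ‖η‖ * Real.cosh ‖η‖ *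
          (⟪b, x.diff p w'⟫ - ⟪b', x.diff p w⟫) +
        (potentialDeriv n (Real.cosh (2 * ‖η‖)) *
          (sinhc ‖η‖ ^ 2 + sinhcDeriv ‖η‖ * Real.cosh ‖η‖) +
          4 * Real.cosh ‖η‖ ^ 2 * sinhc ‖η‖ ^ 2 * potentialDeriv2 n (Real.cosh (2 * ‖η‖))) *
          (⟪η, b⟫ * ⟪η, x.diff p w'⟫ - ⟪η, b'⟫ * ⟪η, x.diff p w⟫)) : ℝ) : ℂ) := by
  have h : Real.cosh (2 * ‖η‖) = Real.cosh ‖η‖ ^ 2 + sinhc ‖η‖ ^ 2 * ⟪η, η⟫ := by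
    rw [Real.cosh_two_mul, real_inner_self_eq_norm_sq, ← mul_pow, sinhc_mul_self]
  rw [toQuadric_eq, h]
  exact kahlerForm_pushforward (x.inner_pt_self p) hη (x.inner_pt_diff p w) (x.inner_pt_diff p w')
    hb hb' (sinhc_add_mul_inner η)

/-- A twisted conormal bundle which is Lagrangian is not twisted. -/
theorem form_eq_zero_of_isLagrangian (hqn : q < n) (hμ : IsSmoothOneForm μ)
    (h : x.IsLagrangian μ) (p : L) : μ p = 0 := by
  rcases Nat.eq_zero_or_pos q with rfl | hq
  · ext w
    have : w = 0 := Subsingleton.elim (α := E 0) w 0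
    rw [this, map_zero, map_zero]
  have hrank := finrank_normal (x.inner_pt_self p) (x.inner_pt_diff p) (x.diff_injective p)
    (x.normal_spec p)
  have hne : x.normal p ≠ ⊥ := fun hbot => by
    rw [hbot, finrank_bot] at hrank; omega
  obtain ⟨ξ, hξ, hξ0⟩ := Submodule.exists_mem_ne_zero_of_ne_bot hne
  suffices hw : ∀ w, formAt μ p w = 0 from ContinuousLinearMap.ext hw
  intro w
  obtain ⟨b, hb, -, hY⟩ := x.exists_isTangentVector p hμ hξ w
  have hY := hY 0 (zero_mem _)
  rw [add_zero] at hY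
  have hη := x.add_sharp_mem_twistedFibre p (μ := μ) hξ
  have hX := x.isTangentVector_vertical p hη hξ
  have h1 := h p _ hη _ _ hX hY
  set η := ξ + x.sharp μ p with hηdef
  have hηpt := x.inner_pt_of_mem_twistedFibre p hη
  have hηξ : ⟪η, ξ⟫ = ⟪ξ, ξ⟫ := by
    rw [hηdef, inner_add_left, sharp]
    rw [show ⟪tangentialLift (x.diff p) (formAt μ p), ξ⟫ = 0 from hξ.2 _, add_zero]
  have hξpos : 0 < ⟪ξ, ξ⟫ := real_inner_self_pos.2 hξ0
  have hη0 : 0 < ‖η‖ := by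
    rw [norm_pos_iff]
    rintro h0
    rw [h0, inner_zero_left] at hηξ
    exact hξpos.ne hηξ
  rw [← map_zero (x.diff p), x.kahlerForm_embed hηpt (by rw [hξ.1]; simp) hb,
    x.inner_of_mem_normal p hξ, map_zero, inner_zero_right, inner_zero_right, hηξ,
    sinhc_of_ne hη0.ne', sinhcDeriv, sinhc_of_ne hη0.ne'] at h1
  have h2 := kahler_radial_coefficient_pos (by omega : 2 ≤ n) hη0
  have h3 := Complex.ofReal_eq_zero.1 h1
  rw [← x.inner_diff_of_mem_twistedFibre p hη w]
  simp only [sub_zero, mul_zero, zero_add, neg_eq_zero, mul_eq_zero, h2.ne', hξpos.ne',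
    false_or] at h3
  exact h3

/-- The untwisted conormal bundle is Lagrangian. -/
theorem isLagrangian_of_form_eq_zero (hμ0 : ∀ p, μ p = 0) : x.IsLagrangian μ := by
  intro p η hη X Y hX hY
  obtain ⟨w, b, rfl, hb, hc⟩ := hX.exists_embed
  obtain ⟨w', b', rfl, hb', hc'⟩ := hY.exists_embed
  have hN := x.mem_normal_of_mem_twistedFibre p hμ0 hη
  rw [x.kahlerForm_embed (x.inner_pt_of_mem_twistedFibre p hη) hb hb',
    x.inner_of_mem_normal p hN, x.inner_of_mem_normal p hN, real_inner_comm _ b,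
    real_inner_comm _ b', (hc hμ0).2, (hc' hμ0).2, hessian_symm]
  simp

/-- The coordinate matrix of an endomorphism of `ℝ^q`. -/
abbrev coordMatrix (A : E q →ₗ[ℝ] E q) : Matrix (Fin q) (Fin q) ℝ :=
  LinearMap.toMatrix (EuclideanSpace.basisFun (Fin q) ℝ).toBasis
    (EuclideanSpace.basisFun (Fin q) ℝ).toBasis A

/-- The factor of the holomorphic volume form that depends on the second fundamental form. -/
def shapeDet (ξ : E (n + 1)) (A : E q →ₗ[ℝ] E q) : ℂ :=
  ((Real.cosh ‖ξ‖ : ℂ) • (1 : Matrix (Fin q) (Fin q) ℂ) +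
    (Complex.I * (sinhc ‖ξ‖ : ℂ)) • (coordMatrix A).map Complex.ofReal).det

omit [IsManifold (𝓡 q) ∞ L] in
theorem isConormalVelocity_of_shape {ξ ν : E (n + 1)} {A : E q →ₗ[ℝ] E q}
    (hA : ∀ w w', ⟪x.diff p w', x.diff p (A w)⟫ = -⟪x.hessian p w w', ξ⟫) (hν : ν ∈ x.normal p)
    (w : E q) : x.IsConormalVelocity (p := p) ξ w (x.diff p (A w) + ν) := by
  refine ⟨by rw [inner_add_right, x.inner_pt_diff, hν.1, add_zero], fun w' => ?_⟩
  rw [inner_add_right, hA, ((x.mem_normal p).1 hν).2, add_zero]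

omit [IsManifold (𝓡 q) ∞ L] in
theorem sub_mem_normal_of_shape {ξ b : E (n + 1)} {A : E q →ₗ[ℝ] E q}
    (hA : ∀ w w', ⟪x.diff p w', x.diff p (A w)⟫ = -⟪x.hessian p w w', ξ⟫) {w : E q}
    (hb : x.IsConormalVelocity (p := p) ξ w b) : b - x.diff p (A w) ∈ x.normal p := by
  refine (x.mem_normal p).2 ⟨by rw [inner_sub_right, hb.1, x.inner_pt_diff, sub_zero], fun w' => ?_⟩
  rw [inner_sub_right, hA, hb.2, sub_self]

omit [IsManifold (𝓡 q) ∞ L] in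
/-- The holomorphic volume form on the conormal bundle. -/
theorem exists_holVolForm_eq {ξ : E (n + 1)} (hξ : ξ ∈ x.normal p) (A : E q →ₗ[ℝ] E q) :
    ∃ ρ : (Fin n → E q) → (Fin n → x.normal p) → ℝ, (∃ w ν, ρ w ν ≠ 0) ∧ ∀ w ν,
      holVolForm (toQuadric (x.pt p) ξ) (fun j => x.embed p ξ (x.diff p (w j))
        (x.diff p (A (w j)) + (ν j : E (n + 1)))) =
      (ρ w ν : ℂ) * (Complex.I ^ (n - q) * shapeDet ξ A) := by
  obtain ⟨ρ, h0, h⟩ := holVolForm_pushforward (d := (x.diff p).toLinearMap) (x.inner_pt_self p)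
    (x.inner_pt_diff p) (x.diff_injective p) (x.normal_spec p) A ⟨ξ, hξ⟩
    (sinhc_pos (norm_nonneg ξ)).ne' (sinhc_add_mul_inner ξ) (cosh_sq_sub_mul_inner ξ)
  refine ⟨ρ, h0, fun w ν => ?_⟩
  rw [toQuadric_eq]
  exact h w ν

theorem im_shapeDet_of_phase {θ : ℝ} (hμ : IsSmoothOneForm μ) (hμ0 : ∀ p, μ p = 0)
    (h : x.IsSpecialLagrangianWithPhase μ θ) {ξ : E (n + 1)} (hξ : ξ ∈ x.normal p)
    {A : E q →ₗ[ℝ] E q}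
    (hA : ∀ w w', ⟪x.diff p w', x.diff p (A w)⟫ = -⟪x.hessian p w w', ξ⟫) :
    (Complex.exp (-(Complex.I * (θ : ℂ))) * Complex.I ^ (n - q) * shapeDet ξ A).im = 0 := by
  obtain ⟨ρ, ⟨w, ν, hρ⟩, hρV⟩ := x.exists_holVolForm_eq hξ A
  have h1 := h.2 p ξ (x.mem_twistedFibre_of_mem_normal p hμ0 hξ) _ fun j =>
    x.isTangentVector_of_isConormalVelocity p hμ hμ0 hξ
      (x.isConormalVelocity_of_shape hA (ν j).2 (w j))
  rw [hρV w ν, mul_left_comm, Complex.im_ofReal_mul, ← mul_assoc] at h1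
  exact (mul_eq_zero.1 h1).resolve_left hρ

theorem isAustere_of_isSpecialLagrangianWithPhase {θ : ℝ} (hμ : IsSmoothOneForm μ)
    (hμ0 : ∀ p, μ p = 0) (h : x.IsSpecialLagrangianWithPhase μ θ) : x.IsAustere := by
  intro ν hν p
  rw [roots_neg_symmetric_iff (LinearMap.charpoly_monic _) (x.splits_charpoly_shapeOperator p hν),
    LinearMap.charpoly_natDegree, finrank_euclideanSpace_fin,
    ← LinearMap.charpoly_toMatrix _ (EuclideanSpace.basisFun (Fin q) ℝ).toBasis]
  set A := x.shapeOperator ν p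
  have hA := x.inner_diff_shapeOperator p hν
  set r := ‖ν p‖ with hr
  have hreal : ∀ t : ℝ, (shapeDet (t • ν p) (t • A)).im = 0 := by
    intro t
    have h0 := x.im_shapeDet_of_phase hμ hμ0 h (zero_mem (x.normal p)) (A := 0) (by simp)
    have h1 := x.im_shapeDet_of_phase hμ hμ0 h
      (Submodule.smul_mem (x.normal p) t (hν.normal p)) (A := t • A) (fun w w' => by
        rw [LinearMap.smul_apply, map_smul, inner_smul_right, inner_smul_right, hA, mul_neg])
    have hone : shapeDet (0 : E (n + 1)) (0 : E q →ₗ[ℝ] E q) = 1 := by simp [shapeDet]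
    rw [hone, mul_one] at h0
    set u := Complex.exp (-(Complex.I * (θ : ℂ))) * Complex.I ^ (n - q) with hu
    have hu0 : u ≠ 0 := mul_ne_zero (Complex.exp_ne_zero _) (pow_ne_zero _ Complex.I_ne_zero)
    have hre : u.re ≠ 0 := fun hre => hu0 (Complex.ext hre h0)
    rw [Complex.mul_im, h0, zero_mul, add_zero] at h1
    exact (mul_eq_zero.1 h1).resolve_left hre
  refine parity_of_det_im_eq_zero _
    ((fun t : ℝ => (Real.cosh (t * r), t * sinhc (t * r))) '' Set.Ioi 0) ?_ ?_ ?_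
  · rw [Set.image_image]
    refine (Set.Ioi_infinite 0).image ?_
    intro t ht u hu htu
    have ht : 0 < t := ht
    have hu : 0 < u := hu
    have hr0 : 0 ≤ r := norm_nonneg _
    have hst := sinhc_pos (r := t * r) (by positivity)
    have hsu := sinhc_pos (r := u * r) (by positivity)
    have h1 : Real.cosh (t * r) * (u * sinhc (u * r)) = Real.cosh (u * r) * (t * sinhc (t * r)) :=
      (div_eq_div_iff (by positivity) (by positivity)).1 htu
    rcases hr0.eq_or_lt with h0 | h0
    · rw [← h0] at h1
      simpa using h1.symm
    · have h2 : Real.sinh (t * r - u * r) = 0 := by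
        rw [Real.sinh_sub, ← sinhc_mul_self, ← sinhc_mul_self]
        linear_combination -r * h1
      exact mul_right_cancel₀ h0.ne' (sub_eq_zero.1 (Real.sinh_eq_zero.1 h2))
  · rintro _ ⟨t, ht, rfl⟩
    have ht : 0 < t := ht
    have := sinhc_pos (r := t * r) (by positivity)
    positivity
  · rintro _ ⟨t, ht, rfl⟩
    have ht : 0 < t := ht
    have h1 := hreal t
    have hnorm : ‖t • ν p‖ = t * r := by rw [norm_smul, Real.norm_of_nonneg ht.le]
    have hmat : (Complex.I * ((t * sinhc (t * r) : ℝ) : ℂ)) • (coordMatrix A).map Complex.ofReal =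
        (Complex.I * (sinhc (t * r) : ℂ)) • (coordMatrix (t • A)).map Complex.ofReal := by
      ext i j
      simp only [coordMatrix, map_smul, Matrix.smul_apply, Matrix.map_apply, smul_eq_mul]
      push_cast
      ring
    rw [shapeDet, hnorm, ← hmat] at h1
    exact h1

theorem isSpecialLagrangianWithPhase_of_isAustere (hμ0 : ∀ p, μ p = 0) (h : x.IsAustere) :
    x.IsSpecialLagrangianWithPhase μ ((n - q : ℕ) * (Real.pi / 2)) := by
  refine ⟨x.isLagrangian_of_form_eq_zero hμ0, fun p η hη V hV => ?_⟩
  have hN := x.mem_normal_of_mem_twistedFibre p hμ0 hη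
  have hν := x.isNormalField_normalProj η
  set A := x.shapeOperator (x.normalProj η) p with hAdef
  have hA : ∀ w w', ⟪x.diff p w', x.diff p (A w)⟫ = -⟪x.hessian p w w', η⟫ := fun w w' => by
    rw [hAdef, x.inner_diff_shapeOperator p hν, x.normalProj_of_mem p hN]
  choose w b hVb _ hb using fun j => (hV j).exists_embed
  obtain ⟨ρ, -, hρ⟩ := x.exists_holVolForm_eq hN A
  have h1 := hρ w fun j => ⟨_, x.sub_mem_normal_of_shape hA (hb j hμ0)⟩
  simp only [add_sub_cancel] at h1
  rw [show V = fun j => x.embed p η (x.diff p (w j)) (b j) from funext hVb, h1]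
  have hphase : Complex.exp (-(Complex.I * (((n - q : ℕ) * (Real.pi / 2) : ℝ) : ℂ))) *
      Complex.I ^ (n - q) = 1 := by
    have hI : Complex.I ^ (n - q) =
        Complex.exp (((n - q : ℕ) : ℂ) * ((Real.pi : ℂ) / 2 * Complex.I)) := by
      rw [Complex.exp_nat_mul, Complex.exp_pi_div_two_mul_I]
    rw [hI, ← Complex.exp_add, ← Complex.exp_zero]
    congr 1
    push_cast
    ring
  rw [mul_left_comm, ← mul_assoc (Complex.exp _), hphase, one_mul, Complex.im_ofReal_mul]
  have hpar := h _ hν p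
  rw [roots_neg_symmetric_iff (LinearMap.charpoly_monic _) (x.splits_charpoly_shapeOperator p hν),
    LinearMap.charpoly_natDegree, finrank_euclideanSpace_fin,
    ← LinearMap.charpoly_toMatrix _ (EuclideanSpace.basisFun (Fin q) ℝ).toBasis] at hpar
  rw [shapeDet, det_im_eq_zero_of_parity _ hpar _ (sinhc_pos (norm_nonneg η)).ne', mul_zero]

end SphereImmersion

end StenzelSphere

end

theorem mainTheorem2 {q n : ℕ} (hqn : q < n)
    {L : Type*} [TopologicalSpace L] [ChartedSpace (StenzelSphere.E q) L] [IsManifold (𝓡 q) ∞ L]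
    (x : StenzelSphere.SphereImmersion q n L)
    (μ : ∀ p : L, TangentSpace (𝓡 q) p →L[ℝ] ℝ) (hμ : StenzelSphere.IsSmoothOneForm μ) :
    x.IsSpecialLagrangian μ ↔ x.IsAustere ∧ ∀ p : L, μ p = 0 := by
  constructor
  · rintro ⟨θ, h⟩
    have hμ0 := x.form_eq_zero_of_isLagrangian hqn hμ h.1
    exact ⟨x.isAustere_of_isSpecialLagrangianWithPhase hμ hμ0 h, hμ0⟩
  · rintro ⟨h, hμ0⟩
    exact ⟨_, x.isSpecialLagrangianWithPhase_of_isAustere hμ0 h⟩
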